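/- Let $d\ge 1$ and let $\Omega\subset\mathbb R^d$ be a bounded domain (no regularity of $\partial\Omega$ is needed when the Dirichlet condition is understood in $H^1_0(\Omega)$). Let $(e_n)$ be an orthonormal basis of $L^2(\Omega)$ consisting of eigenfunctions $e_n\in H_0^1(\Omega)$ of the Dirichlet Laplacian, $-\Delta e_n=\lambda_n e_n$ weakly, $\lambda_n>0$. For $s\ge 0$ put $$\mathbb H^s=\Big\{\varphi\in L^2(\Omega):\ \|\varphi\|_{\mathbb H^s}^2=\sum_n \big|\lambda_n^{s/2}(\varphi,e_n)\big|^2<\infty\Big\},$$ and let $\mathbb H^{-s}$ be its dual, with $\|F\|_{\mathbb H^{-s}}^2=\sum_n|\lambda_n^{-s/2}\langle F,e_n\rangle|^2$. Let $T>0$, $\ell\in L^1(0,T)$ and $\mathcal Hv(t)=\int_0^t\ell(t-\tau)v(\tau)\,d\tau$. Assume: (M) $m\in L^1_{loc}([0,\infty))$ is nonnegative and $a=1+m$ is completely positive, i.e. for every $\kappa>0$ the solutions of $s(t)+\kappa\int_0^t a(t-\tau)s(\tau)\,d\tau=1$ ($t\ge0$) and $r(t)+\kappa\int_0^t a(t-\tau)r(\tau)\,d\tau=a(t)$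 ($t>0$) are nonnegative. (F) $0<\mu<2$, $\theta>0$, $f:\mathbb H^\mu\times\mathbb H^\mu\to\mathbb H^{-\theta}$ satisfies $f(0,0)=0$, and there are nonnegative functions $L_f,K_f$ on $(0,\infty)$ such that for all $\rho,\rho'>0$ $$\|f(v_1,w_1)-f(v_2,w_2)\|_{\mathbb H^{-\theta}}\le L_f(\rho)\|v_1-v_2\|_{\mathbb H^\mu}+K_f(\rho')\|w_1-w_2\|_{\mathbb H^\mu}$$ whenever $\|v_1\|_{\mathbb H^\mu},\|v_2\|_{\mathbb H^\mu}\le\rho$ and $\|w_1\|_{\mathbb H^\mu},\|w_2\|_{\mathbb H^\mu}\le\rho'$. For $\lambda>0$ let $\omega(\cdot,\lambda)$ be the solution of $\omega(t,\lambda)+\lambda\int_0^t(1+m(t-\tau))\,\omega(\tau,\lambda)\,d\tau=1$, $t\ge 0$, and let $S(t)\varphi=\sum_n\omega(t,\lambda_n)\langle\varphi,e_n\rangle e_n$. For $\xi\in\mathbb H^\mu$, a mild solution on $[0,T]$ of the problem $$\partial_t u-\Big(1+\tfrac{d}{dt}\,m*\Big)\Delta u=f(u,\mathcal Hu)\ \text{in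 }\Omega\times(0,T),\qquad u=0\ \text{on }\partial\Omega,\qquad u(0)=\xi$$ is a function $u\in C([0,T];\mathbb H^\mu)$ with $$u(t)=S(t)\xi+\int_0^tS(t-\tau)f(u(\tau),\mathcal Hu(\tau))\,d\tau,\qquad t\in[0,T].$$ **Theorem.** Assume (M), and (F) with $\theta=1+\delta-\mu$, $\delta\in(0,1)$. Let $L_f^*=\limsup_{\rho\to0^+}L_f(\rho)$ and $K_f^*=\limsup_{\rho'\to0^+}K_f(\rho')$ be finite, and suppose $$8\,T^{1-\delta}(1-\delta)^{-1}\big({L_f^*}^2+{K_f^*}^2\|\ell\|_{L^1(0,T)}^2\big)<1.$$ Then there exists $\rho^*>0$ such that for every $\xi\in\mathbb H^\mu$ with $\|\xi\|_{\mathbb H^\mu}\le\frac12\rho^*$ the problem has a mild solution $u$ on $[0,T]$ with $\|u(t)\|_{\mathbb H^\mu}\le\rho^*$ for all $t\in[0,T]$, and $u$ is the only mild solution on $[0,T]$ obeying this bound. -/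

import Mathlib

open MeasureTheory Set Filter Topology
open scoped ContDiff Gradient RealInnerProductSpace

noncomputable section

/-- A bounded domain in `ℝ^d`: a bounded, open, connected (hence nonempty) set. No regularity of
the boundary is imposed. -/
structure BoundedDomain (d : ℕ) where
  carrier : Set (EuclideanSpace ℝ (Fin d))
  isOpen : IsOpen carrier
  isConnected : IsConnected carrier
  isBounded : Bornology.IsBounded carrier

namespace BoundedDomain

variable {d : ℕ}

/-- The real Hilbert space `L²(Ω)`. -/
abbrev L2 (Ω : BoundedDomain d) : Type :=
  Lp ℝ 2 (volume.restrict Ω.carrier)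

/-- The real Hilbert space `L²(Ω; ℝ^d)` of square integrable vector fields. -/
abbrev L2Vec (Ω : BoundedDomain d) : Type :=
  Lp (EuclideanSpace ℝ (Fin d)) 2 (volume.restrict Ω.carrier)

/-- Test functions: elements of `C_c^∞(Ω)`, extended by zero to `ℝ^d`. -/
structure IsTest (Ω : BoundedDomain d) (φ : EuclideanSpace ℝ (Fin d) → ℝ) : Prop where
  smooth : ContDiff ℝ ∞ φ
  compact : HasCompactSupport φ
  supp : tsupport φ ⊆ Ω.carrier

/-- The pairs `(φ, ∇φ)` with `φ ∈ C_c^∞(Ω)`, as elements of `L²(Ω) × L²(Ω; ℝ^d)`. -/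
def testPairs (Ω : BoundedDomain d) : Set (Ω.L2 × Ω.L2Vec) :=
  {p | ∃ φ : EuclideanSpace ℝ (Fin d) → ℝ, Ω.IsTest φ ∧
    p.1 =ᵐ[volume.restrict Ω.carrier] φ ∧ p.2 =ᵐ[volume.restrict Ω.carrier] ∇ φ}

/-- `v` belongs to `H₀¹(Ω)`, the closure of `C_c^∞(Ω)` in `H¹(Ω)`, and `g` is its weak gradient. -/
def IsH01 (Ω : BoundedDomain d) (v : Ω.L2) (g : Ω.L2Vec) : Prop :=
  (v, g) ∈ closure Ω.testPairs

/-- `v ∈ H₀¹(Ω)` and `-Δ v = lam v` in the weak sense. -/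
def IsDirichletEigen (Ω : BoundedDomain d) (v : Ω.L2) (lam : ℝ) : Prop :=
  ∃ g : Ω.L2Vec, Ω.IsH01 v g ∧
    ∀ φ : EuclideanSpace ℝ (Fin d) → ℝ, Ω.IsTest φ →
      ∫ x in Ω.carrier, ⟪g x, ∇ φ x⟫ = lam * ∫ x in Ω.carrier, v x * φ x

/-- Poincaré's inequality for test functions. -/
theorem poincare_test [NeZero d] (Ω : BoundedDomain d) {R : ℝ}
    (hR : ∀ x ∈ Ω.carrier, ‖x‖ ≤ R) {φ : EuclideanSpace ℝ (Fin d) → ℝ} (hφ : Ω.IsTest φ) :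
    ∫ x in Ω.carrier, φ x ^ 2 ≤ 4 * R ^ 2 * ∫ x in Ω.carrier, ‖∇ φ x‖ ^ 2 := by
  have hdiff : Differentiable ℝ φ := hφ.smooth.differentiable (by simp)
  have hcont : Continuous φ := hdiff.continuous
  have hfd : Continuous (fderiv ℝ φ) := hφ.smooth.continuous_fderiv (by simp)
  have hgradnorm : ∀ x, ‖∇ φ x‖ = ‖fderiv ℝ φ x‖ := fun x => by
    simp [gradient]
  have hz : ∀ x, x ∉ Ω.carrier → φ x = 0 := fun x hx =>
    image_eq_zero_of_notMem_tsupport fun h => hx (hφ.supp h)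
  have hz' : ∀ x, x ∉ Ω.carrier → fderiv ℝ φ x = 0 := fun x hx => by
    have : x ∉ tsupport (fderiv ℝ φ) := fun h =>
      hx (hφ.supp (tsupport_fderiv_subset ℝ h))
    exact image_eq_zero_of_notMem_tsupport this
  have hcs' : HasCompactSupport (fderiv ℝ φ) := hφ.compact.fderiv ℝ
  rw [setIntegral_eq_integral_of_forall_compl_eq_zero (fun x hx => by simp [hz x hx]),
    setIntegral_eq_integral_of_forall_compl_eq_zero
      (fun x hx => by simp [hgradnorm, hz' x hx])]
  simp_rw [hgradnorm]
  set e : EuclideanSpace ℝ (Fin d) := EuclideanSpace.single 0 1 with he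
  have hen : ‖e‖ = 1 := by simp [he]
  set c : EuclideanSpace ℝ (Fin d) →L[ℝ] ℝ := EuclideanSpace.proj 0 with hc
  have hce : c e = 1 := by simp [hc, he]
  have hcb : ∀ x, |c x| ≤ ‖x‖ := fun x => by
    have := PiLp.norm_apply_le x 0
    simpa [hc] using this
  have hfsq : ∀ x, fderiv ℝ (fun y => φ y ^ 2) x e = 2 * φ x * fderiv ℝ φ x e := fun x => by
    have h := ((hdiff x).hasFDerivAt.pow 2).fderiv
    rw [h]
    simp
  have hsq_int : Integrable (fun x => φ x ^ 2) :=
    (hcont.pow 2).integrable_of_hasCompactSupport (by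
      apply hφ.compact.mono; intro x hx; simp at hx ⊢; exact hx)
  have hgr_int : Integrable (fun x => ‖fderiv ℝ φ x‖ ^ 2) :=
    (hfd.norm.pow 2).integrable_of_hasCompactSupport (by
      apply hcs'.mono; intro x hx; simp at hx ⊢; exact hx)
  have hcross : Integrable (fun x => 2 * φ x * fderiv ℝ φ x e * c x) := by
    apply Continuous.integrable_of_hasCompactSupport
    · exact ((continuous_const.mul hcont).mul (hfd.clm_apply continuous_const)).mul c.continuous
    · apply hφ.compact.mono; intro x hx; simp at hx ⊢; tauto
  have hparts : ∫ x, φ x ^ 2 = - ∫ x, 2 * φ x * fderiv ℝ φ x e * c x := by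
    have := integral_mul_fderiv_eq_neg_fderiv_mul_of_integrable (μ := volume)
      (f := fun y => φ y ^ 2) (g := fun y => c y) (v := e)
      (by simp_rw [hfsq]; exact hcross)
      (by simpa [hce] using hsq_int)
      (by
        apply Continuous.integrable_of_hasCompactSupport
        · exact (hcont.pow 2).mul c.continuous
        · apply hφ.compact.mono; intro x hx; simp at hx ⊢; tauto)
      (fun x _ => (hdiff x).pow 2) (fun x _ => c.differentiableAt)
    simpa [hfsq, hce] using this
  have hbound : ∫ x, φ x ^ 2 ≤ ∫ x, (1 / 2 * φ x ^ 2 + 2 * R ^ 2 * ‖fderiv ℝ φ x‖ ^ 2) := by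
    rw [hparts, ← integral_neg]
    have hr : Integrable (fun x => 1 / 2 * φ x ^ 2 + 2 * R ^ 2 * ‖fderiv ℝ φ x‖ ^ 2) :=
      (hsq_int.const_mul _).add (hgr_int.const_mul _)
    have hl : Integrable (fun x => -(2 * φ x * fderiv ℝ φ x e * c x)) := hcross.neg
    refine integral_mono hl hr fun x => ?_
    by_cases hx : x ∈ Ω.carrier
    · have h1 : |fderiv ℝ φ x e| ≤ ‖fderiv ℝ φ x‖ := by
        simpa [hen] using (fderiv ℝ φ x).le_opNorm e
      have h2 : |c x| ≤ R := (hcb x).trans (hR x hx)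
      have h3 : |fderiv ℝ φ x e * c x| ≤ ‖fderiv ℝ φ x‖ * R := by
        rw [abs_mul]; gcongr
      have h4 : (fderiv ℝ φ x e * c x) ^ 2 ≤ (‖fderiv ℝ φ x‖ * R) ^ 2 :=
        sq_le_sq' (by linarith [abs_le.1 h3]) (abs_le.1 h3).2
      simp only
      nlinarith [sq_nonneg (φ x + 2 * (fderiv ℝ φ x e * c x))]
    · simp [hz x hx, hz' x hx]
  rw [integral_add (hsq_int.const_mul _) (hgr_int.const_mul _), integral_const_mul,
    integral_const_mul] at hbound
  linarith

/-- Poincaré's inequality in `H₀¹(Ω)`. -/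
theorem poincare_H01 [NeZero d] (Ω : BoundedDomain d) {R : ℝ}
    (hR : ∀ x ∈ Ω.carrier, ‖x‖ ≤ R) {v : Ω.L2} {g : Ω.L2Vec} (h : Ω.IsH01 v g) :
    ‖v‖ ^ 2 ≤ 4 * R ^ 2 * ‖g‖ ^ 2 := by
  have hcl : IsClosed {p : Ω.L2 × Ω.L2Vec | ‖p.1‖ ^ 2 ≤ 4 * R ^ 2 * ‖p.2‖ ^ 2} :=
    isClosed_le (by fun_prop) (by fun_prop)
  have hmem : (v, g) ∈ closure Ω.testPairs := h
  suffices hsub : Ω.testPairs ⊆ {p : Ω.L2 × Ω.L2Vec | ‖p.1‖ ^ 2 ≤ 4 * R ^ 2 * ‖p.2‖ ^ 2} by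
    have h' := closure_minimal hsub hcl hmem
    rwa [mem_ofPred_eq] at h'
  rintro ⟨w, k⟩ ⟨φ, hφ, hw, hk⟩
  have h1 : ‖w‖ ^ 2 = ∫ x in Ω.carrier, φ x ^ 2 := by
    rw [← real_inner_self_eq_norm_sq, L2.inner_def]
    refine integral_congr_ae ?_
    filter_upwards [hw] with x hx
    rw [hx, real_inner_self_eq_norm_sq]; simp
  have h2 : ‖k‖ ^ 2 = ∫ x in Ω.carrier, ‖∇ φ x‖ ^ 2 := by
    rw [← real_inner_self_eq_norm_sq, L2.inner_def]
    refine integral_congr_ae ?_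
    filter_upwards [hk] with x hx
    rw [hx, real_inner_self_eq_norm_sq]
  simp only [mem_ofPred_eq, h1, h2]
  exact Ω.poincare_test hR hφ

/-- The Dirichlet eigenvalues are bounded below by a positive constant. -/
theorem exists_eigenvalue_lower_bound [NeZero d] (Ω : BoundedDomain d) :
    ∃ c > 0, ∀ (v : Ω.L2) (lam : ℝ), ‖v‖ = 1 → Ω.IsDirichletEigen v lam → c ≤ lam := by
  obtain ⟨R, hR0, hR⟩ := Ω.isBounded.exists_pos_norm_le
  refine ⟨(4 * R ^ 2)⁻¹, by positivity, ?_⟩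
  rintro v lam hv ⟨g, hg, heq⟩
  have hcl : IsClosed {p : Ω.L2 × Ω.L2Vec | ⟪g, p.2⟫ = lam * ⟪v, p.1⟫} :=
    isClosed_eq (by fun_prop) (by fun_prop)
  have hmem : (v, g) ∈ {p : Ω.L2 × Ω.L2Vec | ⟪g, p.2⟫ = lam * ⟪v, p.1⟫} := by
    refine closure_minimal ?_ hcl hg
    rintro ⟨w, k⟩ ⟨φ, hφ, hw, hk⟩
    have h := heq φ hφ
    simp only [mem_ofPred_eq, L2.inner_def]
    convert h using 1
    · refine integral_congr_ae ?_
      filter_upwards [hk] with x hx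
      rw [hx]
    · congr 1
      refine integral_congr_ae ?_
      filter_upwards [hw] with x hx
      rw [hx]; simp [mul_comm]
  simp only [mem_ofPred_eq, real_inner_self_eq_norm_sq, hv] at hmem
  have hp := Ω.poincare_H01 hR hg
  rw [hmem, hv] at hp
  rw [inv_le_iff_one_le_mul₀' (by positivity)]
  linarith

end BoundedDomain

/-- A sequence of eigenfunctions `e n` of the Dirichlet Laplacian `-Δ` on `Ω`, with eigenvalues
`lam n`, that forms an orthonormal basis of `L²(Ω)`. -/
structure DirichletEigenbasis {d : ℕ} (Ω : BoundedDomain d) where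
  e : HilbertBasis ℕ ℝ Ω.L2
  lam : ℕ → ℝ
  isEigen : ∀ n, Ω.IsDirichletEigen (e n) (lam n)

namespace DirichletEigenbasis

variable {d : ℕ} {Ω : BoundedDomain d}

theorem exists_lower_bound [NeZero d] (E : DirichletEigenbasis Ω) : ∃ c > 0, ∀ n, c ≤ E.lam n := by
  obtain ⟨c, hc, h⟩ := Ω.exists_eigenvalue_lower_bound
  exact ⟨c, hc, fun n => h _ _ (E.e.orthonormal.1 n) (E.isEigen n)⟩

theorem lam_pos [NeZero d] (E : DirichletEigenbasis Ω) (n : ℕ) : 0 < E.lam n := by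
  obtain ⟨c, hc, h⟩ := E.exists_lower_bound
  exact hc.trans_le (h n)

/-- The linear subspace `{φ ∈ L²(Ω) | ∑ₙ |λₙ^{s/2} (φ, eₙ)|² < ∞}` of `L²(Ω)`. -/
def scaleSubmodule (E : DirichletEigenbasis Ω) (s : ℝ) : Submodule ℝ Ω.L2 where
  carrier := {φ | Summable fun n => (E.lam n ^ (s / 2) * ⟪φ, E.e n⟫) ^ 2}
  zero_mem' := by simp
  add_mem' := by
    intro φ ψ hφ hψ
    refine Summable.of_nonneg_of_le (fun n => sq_nonneg _) (fun n => ?_)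
      ((hφ.mul_left 2).add (hψ.mul_left 2))
    rw [inner_add_left]
    nlinarith [sq_nonneg (E.lam n ^ (s / 2) * ⟪φ, E.e n⟫ - E.lam n ^ (s / 2) * ⟪ψ, E.e n⟫)]
  smul_mem' := by
    intro c φ hφ
    refine (hφ.mul_left (c ^ 2)).congr fun n => ?_
    rw [real_inner_smul_left]; ring

/-- The space `ℍ^s` of the Hilbert scale, for `s ≥ 0`. It carries its own norm, not that of
`L²(Ω)`; see `H.norm_sq`. -/
def H (E : DirichletEigenbasis Ω) (s : ℝ) : Type := ↥(E.scaleSubmodule s)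

namespace H

variable {E : DirichletEigenbasis Ω} {s : ℝ}

instance : AddCommGroup (E.H s) := inferInstanceAs (AddCommGroup ↥(E.scaleSubmodule s))

instance : Module ℝ (E.H s) := inferInstanceAs (Module ℝ ↥(E.scaleSubmodule s))

variable (E s) in
/-- The inclusion of `ℍ^s` in `L²(Ω)`. -/
def toL2 : E.H s →ₗ[ℝ] Ω.L2 := (E.scaleSubmodule s).subtype

theorem memlp_two {a : ℕ → ℝ} (h : Summable fun n => a n ^ 2) :
    Memℓp (E := fun _ : ℕ => ℝ) a 2 :=
  memℓp_gen (by simpa [Real.norm_eq_abs, sq_abs] using h)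

variable (E s) in
/-- `φ ↦ (λₙ^{s/2} (φ, eₙ))ₙ`, from `ℍ^s` to `ℓ²`. -/
def toSeq : E.H s →ₗ[ℝ] lp (fun _ : ℕ => ℝ) 2 where
  toFun φ := ⟨fun n => E.lam n ^ (s / 2) * ⟪toL2 E s φ, E.e n⟫, memlp_two φ.2⟩
  map_add' φ ψ := by
    ext n
    simp only [map_add, inner_add_left, mul_add]
    rfl
  map_smul' c φ := by
    ext n
    simp [real_inner_smul_left, mul_left_comm]

theorem toSeq_apply (φ : E.H s) (n : ℕ) :
    toSeq E s φ n = E.lam n ^ (s / 2) * ⟪toL2 E s φ, E.e n⟫ := rfl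

theorem toSeq_injective [NeZero d] : Function.Injective (toSeq E s) := by
  rw [injective_iff_map_eq_zero]
  intro φ hφ
  apply Subtype.ext
  change toL2 E s φ = 0
  apply E.e.repr.injective
  ext n
  have h := congrArg (fun a : lp (fun _ : ℕ => ℝ) 2 => a n) hφ
  simp only [toSeq_apply, lp.coeFn_zero, Pi.zero_apply, mul_eq_zero] at h
  rw [HilbertBasis.repr_apply_apply, real_inner_comm]
  simpa using h.resolve_left (Real.rpow_pos_of_pos (E.lam_pos n) _).ne'

instance [NeZero d] : NormedAddCommGroup (E.H s) :=
  NormedAddCommGroup.induced (E.H s) (lp (fun _ : ℕ => ℝ) 2) (toSeq E s) toSeq_injective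

instance [NeZero d] : NormedSpace ℝ (E.H s) :=
  NormedSpace.induced ℝ (E.H s) (lp (fun _ : ℕ => ℝ) 2) (toSeq E s)

/-- `‖φ‖²_{ℍ^s} = ∑ₙ |λₙ^{s/2} (φ, eₙ)|²`. -/
theorem norm_sq [NeZero d] (φ : E.H s) :
    ‖φ‖ ^ 2 = ∑' n, (E.lam n ^ (s / 2) * ⟪toL2 E s φ, E.e n⟫) ^ 2 := by
  have h : ‖φ‖ = ‖toSeq E s φ‖ := rfl
  have h2 := lp.norm_rpow_eq_tsum (p := 2) (by norm_num) (toSeq E s φ)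
  simp only [ENNReal.toReal_ofNat, Real.rpow_two, Real.norm_eq_abs, sq_abs] at h2
  rw [h, h2]
  rfl

theorem toSeq_surjective [NeZero d] (hs : 0 ≤ s) : Function.Surjective (toSeq E s) := by
  intro a
  obtain ⟨c, hc, hlam⟩ := E.exists_lower_bound
  have hle : ∀ n, E.lam n ^ (-(s / 2)) ≤ c ^ (-(s / 2)) := fun n =>
    Real.rpow_le_rpow_of_nonpos hc (hlam n) (by linarith)
  have hmul : ∀ n, E.lam n ^ (s / 2) * (E.lam n ^ (-(s / 2)) * a n) = a n := fun n => by
    rw [← mul_assoc, ← Real.rpow_add (E.lam_pos n)]; simp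
  have ha : Summable fun n => (a n) ^ 2 := by
    have := (lp.memℓp a).summable (by norm_num)
    simpa using this
  have hb : Summable fun n => (E.lam n ^ (-(s / 2)) * a n) ^ 2 := by
    refine Summable.of_nonneg_of_le (fun n => sq_nonneg _) (fun n => ?_)
      (ha.mul_left ((c ^ (-(s / 2))) ^ 2))
    rw [mul_pow]
    have h0 := Real.rpow_nonneg (E.lam_pos n).le (-(s / 2))
    have := hle n
    gcongr
  let b : lp (fun _ : ℕ => ℝ) 2 := ⟨fun n => E.lam n ^ (-(s / 2)) * a n, memlp_two hb⟩
  have hcoef : ∀ n, ⟪E.e.repr.symm b, E.e n⟫ = E.lam n ^ (-(s / 2)) * a n := fun n => by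
    rw [real_inner_comm, ← HilbertBasis.repr_apply_apply, LinearIsometryEquiv.apply_symm_apply]
  refine ⟨⟨E.e.repr.symm b, ?_⟩, ?_⟩
  · change Summable fun n => (E.lam n ^ (s / 2) * ⟪E.e.repr.symm b, E.e n⟫) ^ 2
    simpa only [hcoef, hmul] using ha
  · ext n
    change E.lam n ^ (s / 2) * ⟪E.e.repr.symm b, E.e n⟫ = a n
    rw [hcoef, hmul]

/-- For `s ≥ 0`, the map `φ ↦ (λₙ^{s/2} (φ, eₙ))ₙ` is an isometry of `ℍ^s` onto `ℓ²`. -/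
def seqEquiv [NeZero d] (hs : 0 ≤ s) : E.H s ≃ₗᵢ[ℝ] lp (fun _ : ℕ => ℝ) 2 where
  toLinearEquiv := LinearEquiv.ofBijective (toSeq E s) ⟨toSeq_injective, toSeq_surjective hs⟩
  norm_map' _ := rfl

/-- For `s ≥ 0` the space `ℍ^s` is complete. -/
theorem completeSpace [NeZero d] (hs : 0 ≤ s) : CompleteSpace (E.H s) :=
  (seqEquiv hs).toIsometryEquiv.completeSpace_iff.2 inferInstance

end H

/-- The eigenfunction `e n` as an element of `ℍ^s`. -/
def eigen (E : DirichletEigenbasis Ω) (s : ℝ) (n : ℕ) : E.H s :=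
  ⟨E.e n, by
    change Summable fun k => (E.lam k ^ (s / 2) * ⟪E.e n, E.e k⟫) ^ 2
    refine summable_of_ne_finset_zero (s := {n}) fun k hk => ?_
    have : ⟪E.e n, E.e k⟫ = 0 := E.e.orthonormal.2 (by simpa [eq_comm] using hk)
    simp [this]⟩

/-- The dual space `ℍ^{-s}` of `ℍ^s`, with the dual norm; see `HNeg.norm_sq`. -/
abbrev HNeg [NeZero d] (E : DirichletEigenbasis Ω) (s : ℝ) : Type := StrongDual ℝ (E.H s)

/-- `‖F‖²_{ℍ^{-s}} = ∑ₙ |λₙ^{-s/2} ⟨F, eₙ⟩|²`. -/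
theorem HNeg.norm_sq [NeZero d] {E : DirichletEigenbasis Ω} {s : ℝ} (hs : 0 ≤ s) (F : E.HNeg s) :
    ‖F‖ ^ 2 = ∑' n, (E.lam n ^ (-(s / 2)) * F (E.eigen s n)) ^ 2 := by
  let J : E.H s ≃ₗᵢ[ℝ] lp (fun _ : ℕ => ℝ) 2 := H.seqEquiv hs
  let G : StrongDual ℝ (lp (fun _ : ℕ => ℝ) 2) := F.comp (J.symm.toContinuousLinearEquiv : _ →L[ℝ] _)
  have hG : ‖G‖ = ‖F‖ := F.opNorm_comp_linearIsometryEquiv J.symm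
  let a := (InnerProductSpace.toDual ℝ (lp (fun _ : ℕ => ℝ) 2)).symm G
  have ha : ‖a‖ = ‖F‖ := by rw [← hG]; exact LinearIsometryEquiv.norm_map _ _
  have hJ : ∀ n, J.symm (lp.single 2 n (1 : ℝ)) = E.lam n ^ (-(s / 2)) • E.eigen s n := fun n => by
    rw [LinearIsometryEquiv.symm_apply_eq, map_smul]
    ext k
    change _ = E.lam n ^ (-(s / 2)) * (E.lam k ^ (s / 2) * ⟪E.e n, E.e k⟫)
    rcases eq_or_ne k n with rfl | hk
    · rw [real_inner_self_eq_norm_sq, E.e.orthonormal.1, ← mul_assoc,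
        ← Real.rpow_add (E.lam_pos k)]
      simp
    · rw [E.e.orthonormal.2 hk.symm]
      simp [hk]
  have hcoef : ∀ n, a n = E.lam n ^ (-(s / 2)) * F (E.eigen s n) := fun n => by
    have h1 : ⟪a, lp.single 2 n (1 : ℝ)⟫ = G (lp.single 2 n (1 : ℝ)) :=
      InnerProductSpace.toDual_symm_apply
    have h2 : G (lp.single 2 n (1 : ℝ)) = F (J.symm (lp.single 2 n (1 : ℝ))) := rfl
    rw [lp.inner_single_right, h2, hJ, map_smul] at h1
    simpa using h1
  have h2 := lp.norm_rpow_eq_tsum (p := 2) (by norm_num) a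
  simp only [ENNReal.toReal_ofNat, Real.rpow_two, Real.norm_eq_abs, sq_abs] at h2
  rw [← ha, h2]
  simp_rw [hcoef]

end DirichletEigenbasis

/-- `w` solves `w(t) + θ ∫₀ᵗ a(t - τ) w(τ) dτ = 1` for all `t ≥ 0`. (For a locally integrable
kernel `a` on `[0, ∞)` this equation has exactly one solution, and it is continuous.) -/
def IsRelaxation (a : ℝ → ℝ) (θ : ℝ) (w : ℝ → ℝ) : Prop :=
  ContinuousOn w (Ici 0) ∧ ∀ t, 0 ≤ t → w t + θ * ∫ τ in (0 : ℝ)..t, a (t - τ) * w τ = 1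

/-- `r` is a locally integrable solution of `r(t) + θ ∫₀ᵗ a(t - τ) r(τ) dτ = a(t)`, `t > 0`, where
functions are identified if they agree almost everywhere. -/
def IsIntegratedResolvent (a : ℝ → ℝ) (θ : ℝ) (r : ℝ → ℝ) : Prop :=
  LocallyIntegrableOn r (Ici 0) ∧
    ∀ᵐ t ∂volume.restrict (Ioi 0), r t + θ * ∫ τ in (0 : ℝ)..t, a (t - τ) * r τ = a t

/-- Complete positivity of a locally integrable kernel `a`: for each `θ > 0` the solutions of the
two Volterra equations above are nonnegative. -/
def CompletelyPositive (a : ℝ → ℝ) : Prop :=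
  ∀ θ : ℝ, 0 < θ →
    (∃ w, IsRelaxation a θ w ∧ ∀ t, 0 ≤ t → 0 ≤ w t) ∧
    (∃ r, IsIntegratedResolvent a θ r ∧ ∀ᵐ t ∂volume.restrict (Ioi 0), 0 ≤ r t)

/-- The standing hypothesis on the kernel `m ∈ L¹_loc([0, ∞))`: it is nonnegative and `1 + m` is
completely positive. -/
structure ConditionM (m : ℝ → ℝ) : Prop where
  locInt : LocallyIntegrableOn m (Ici 0)
  nonneg : ∀ᵐ t ∂volume.restrict (Ioi 0), 0 ≤ m t
  completelyPositive : CompletelyPositive fun t => 1 + m t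

/-- The relaxation function `ω(t, lam)`: the solution of
`ω(t) + lam ∫₀ᵗ (1 + m(t - τ)) ω(τ) dτ = 1`, `t ≥ 0`. -/
def relaxation (m : ℝ → ℝ) (t lam : ℝ) : ℝ :=
  Classical.epsilon (IsRelaxation (fun t => 1 + m t) lam) t

namespace DirichletEigenbasis

variable {d : ℕ} [NeZero d] {Ω : BoundedDomain d}

/-- The resolvent operator on `ℍ^s`: `S(t) ξ = ∑ₙ ω(t, λₙ) (ξ, eₙ) eₙ`. -/
def resolvent (E : DirichletEigenbasis Ω) (m : ℝ → ℝ) (s t : ℝ) (ξ : E.H s) : E.H s :=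
  ∑' n, (relaxation m t (E.lam n) * ⟪H.toL2 E s ξ, E.e n⟫) • E.eigen s n

/-- The resolvent operator on `ℍ^{-θ}`, with values in `ℍ^s`:
`S(t) F = ∑ₙ ω(t, λₙ) ⟨F, eₙ⟩ eₙ`, the series being taken in `ℍ^s`. -/
def resolventNeg (E : DirichletEigenbasis Ω) (m : ℝ → ℝ) (θ s t : ℝ) (F : E.HNeg θ) : E.H s :=
  ∑' n, (relaxation m t (E.lam n) * F (E.eigen θ n)) • E.eigen s n

/-- The history operator `𝓗 v(t) = ∫₀ᵗ ℓ(t - τ) v(τ) dτ`. -/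
def history {E : DirichletEigenbasis Ω} {s : ℝ} (ℓ : ℝ → ℝ) (v : ℝ → E.H s) (t : ℝ) : E.H s :=
  ∫ τ in (0 : ℝ)..t, ℓ (t - τ) • v τ

/-- `u ∈ C([0,T]; ℍ^μ)` is a mild solution with initial value `ξ` and nonlinearity
`f : ℍ^μ × ℍ^μ → ℍ^{-θ}`:
`u(t) = S(t) ξ + ∫₀ᵗ S(t - τ) f(u(τ), 𝓗u(τ)) dτ` for `t ∈ [0,T]`. -/
def IsMildSolution (E : DirichletEigenbasis Ω) (m ℓ : ℝ → ℝ) (T μ θ : ℝ)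
    (f : E.H μ → E.H μ → E.HNeg θ) (ξ : E.H μ) (u : ℝ → E.H μ) : Prop :=
  ContinuousOn u (Icc 0 T) ∧
    ∀ t ∈ Icc 0 T, u t = E.resolvent m μ t ξ +
      ∫ τ in (0 : ℝ)..t, E.resolventNeg m θ μ (t - τ) (f (u τ) (history ℓ u τ))

/-- The hypothesis on the nonlinearity `f : ℍ^μ × ℍ^μ → ℍ^{-θ}`: it vanishes at `(0, 0)` and is
locally Lipschitz, with constants `L ρ` and `K ρ'` on balls of radii `ρ` and `ρ'`. -/
structure ConditionF (E : DirichletEigenbasis Ω) (μ θ : ℝ) (f : E.H μ → E.H μ → E.HNeg θ)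
    (L K : ℝ → ℝ) : Prop where
  mu_pos : 0 < μ
  mu_lt_two : μ < 2
  theta_pos : 0 < θ
  map_zero : f 0 0 = 0
  L_nonneg : ∀ ρ, 0 < ρ → 0 ≤ L ρ
  K_nonneg : ∀ ρ, 0 < ρ → 0 ≤ K ρ
  lipschitz : ∀ ρ ρ' : ℝ, 0 < ρ → 0 < ρ' → ∀ v₁ v₂ w₁ w₂ : E.H μ,
    ‖v₁‖ ≤ ρ → ‖v₂‖ ≤ ρ → ‖w₁‖ ≤ ρ' → ‖w₂‖ ≤ ρ' →
    ‖f v₁ w₁ - f v₂ w₂‖ ≤ L ρ * ‖v₁ - v₂‖ + K ρ' * ‖w₁ - w₂‖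

end DirichletEigenbasis

end

/-!
A mild solution is a fixed point of `u ↦ S(·)ξ + S * f(u, ℓ * u)` in a ball of `C([0, T]; ℍ^μ)`, and
the point is to bound the convolution with `S`, which maps `ℍ^{-θ}` to `ℍ^μ`, by
`(T^{1-δ} / (1 - δ))^{1/2}` in the sup norms.

Complete positivity supplies what is needed about the scalar functions `ω = ω(·, λ)`. By uniqueness
for the Volterra equation (`IsRelaxation.eqOn`), `ω` is the nonnegative solution, and it equals
`1 - λ ∫ r` with `r ≥ 0` (`IsIntegratedResolvent.isRelaxation`), so it decreases from `1`. As `m ≥ 0`,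
the equation also gives `λ ∫₀ᵗ ω ≤ 1`, hence `λ t ω(t) ≤ 1` by monotonicity, and interpolation yields
`λ^p ω(t) ≤ t^{-p}` for `0 ≤ p ≤ 1` (`ConditionM.rpow_mul_relaxation_le`).

In the coordinates of the eigenbasis `S(t)` is multiplication by `λₙ^{(μ+θ)/2} ω(t, λₙ)` on `ℓ²`, where
`μ + θ = 1 + δ`. Jensen's inequality with the weight `λₙ ω(t - τ, λₙ)` and `λₙ^δ ω(t - τ, λₙ) ≤
(t - τ)^{-δ}` give `‖∫₀ᵗ S(t - τ) g(τ) dτ‖² ≤ ∫₀ᵗ (t - τ)^{-δ} ‖g(τ)‖² dτ`, from which the bound follows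
(`DirichletEigenbasis.norm_integral_resolventNeg_le`). The weaker bound `‖S(t)‖ ≤ t^{-(1+δ)/2}` is
integrable and makes the convolution continuous in time.

If `ρ` and `ρ'` are small enough, the smallness hypothesis and `(x + y)² ≤ 2 (x² + y²)` turn this into
the Lipschitz constant `1/2` on the ball of radius `ρ`. That ball is mapped into itself when
`‖ξ‖ ≤ ρ / 2`, and Banach's theorem applies (`exists_unique_volterraSolution`).
-/

/-! ### Scalar Volterra equations -/

/-- A large exponential weight makes the mass of an integrable kernel small. -/
theorem exists_exp_weight_lt {a : ℝ → ℝ} {T : ℝ} (ha : IntegrableOn a (Ioc 0 T)) (κ : ℝ) :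
    ∃ β : ℝ, |κ| * ∫ t in Ioc 0 T, Real.exp (-(β * t)) * |a t| < 1 := by
  have h : Tendsto (fun β : ℝ => |κ| * ∫ t in Ioc 0 T, Real.exp (-(β * t)) * |a t|) atTop
      (𝓝 (|κ| * ∫ t in Ioc 0 T, (0 : ℝ))) := by
    refine Tendsto.const_mul _ ?_
    refine tendsto_integral_filter_of_dominated_convergence (fun t => |a t|) ?_ ?_ ha.abs ?_
    · refine Eventually.of_forall fun β => ?_
      exact (Continuous.aestronglyMeasurable (by fun_prop)).mul ha.abs.aestronglyMeasurable
    · filter_upwards [eventually_ge_atTop 0] with β hβ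
      filter_upwards [ae_restrict_mem measurableSet_Ioc] with t ht
      rw [Real.norm_eq_abs, abs_mul, abs_abs, Real.abs_exp]
      refine mul_le_of_le_one_left (abs_nonneg _) (Real.exp_le_one_iff.2 ?_)
      have := mul_nonneg hβ ht.1.le
      linarith
    · filter_upwards [ae_restrict_mem measurableSet_Ioc] with t ht
      rw [← zero_mul |a t|]
      refine Tendsto.mul_const _ ?_
      refine Real.tendsto_exp_neg_atTop_nhds_zero.comp ?_
      exact tendsto_id.atTop_mul_const ht.1
  simp only [integral_zero, mul_zero] at h
  exact (h.eventually_lt_const one_pos).exists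

/-- Reflecting the kernel: `τ ↦ a (t - τ)` is integrable on `[0, t]`. -/
theorem intervalIntegrable_reflect {a : ℝ → ℝ} {t : ℝ} (ht : 0 ≤ t)
    (ha : IntegrableOn a (Ioc 0 t)) : IntervalIntegrable (fun τ => a (t - τ)) volume 0 t := by
  have h : IntervalIntegrable a volume 0 t :=
    (intervalIntegrable_iff_integrableOn_Ioc_of_le ht).2 ha
  simpa using (h.comp_sub_left t).symm

theorem intervalIntegrable_reflect_mul {a w : ℝ → ℝ} {t : ℝ} (ht : 0 ≤ t)
    (ha : IntegrableOn a (Ioc 0 t)) (hw : ContinuousOn w (Icc 0 t)) :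
    IntervalIntegrable (fun τ => a (t - τ) * w τ) volume 0 t :=
  (intervalIntegrable_reflect ht ha).mul_continuousOn (by rwa [uIcc_of_le ht])

/-- Continuous solutions of `w + κ a * w = 1` are unique: with the weight `e^{-βt}`, `β` large,
`z ↦ κ a * z` is a strict contraction on `[0, t]`. -/
theorem IsRelaxation.eqOn {a : ℝ → ℝ} (ha : ∀ t, IntegrableOn a (Ioc 0 t)) {κ : ℝ}
    {w₁ w₂ : ℝ → ℝ} (h₁ : IsRelaxation a κ w₁) (h₂ : IsRelaxation a κ w₂) :
    EqOn w₁ w₂ (Ici 0) := by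
  intro T hT
  obtain ⟨β, hβ⟩ := exists_exp_weight_lt (ha T) κ
  set z : ℝ → ℝ := fun t => w₁ t - w₂ t with hz
  have hzc : ContinuousOn z (Ici 0) := h₁.1.sub h₂.1
  have hzeq : ∀ t, 0 ≤ t → z t = -κ * ∫ τ in (0 : ℝ)..t, a (t - τ) * z τ := fun t ht => by
    have e₁ := h₁.2 t ht
    have e₂ := h₂.2 t ht
    have i₁ := intervalIntegrable_reflect_mul ht (ha t) (h₁.1.mono Icc_subset_Ici_self)
    have i₂ := intervalIntegrable_reflect_mul ht (ha t) (h₂.1.mono Icc_subset_Ici_self)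
    have : ∫ τ in (0 : ℝ)..t, a (t - τ) * z τ =
        (∫ τ in (0 : ℝ)..t, a (t - τ) * w₁ τ) - ∫ τ in (0 : ℝ)..t, a (t - τ) * w₂ τ := by
      rw [← intervalIntegral.integral_sub i₁ i₂]
      simp only [hz, mul_sub]
    rw [this]
    simp only [hz]
    linarith
  obtain ⟨s, hs, hmax⟩ := isCompact_Icc.exists_isMaxOn (nonempty_Icc.2 hT)
    (f := fun t => Real.exp (-(β * t)) * |z t|)
    ((Continuous.continuousOn (by fun_prop)).mul (hzc.mono Icc_subset_Ici_self).abs)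
  set M := Real.exp (-(β * s)) * |z s| with hM
  have hM0 : 0 ≤ M := by positivity
  have hbound : ∀ t ∈ Icc 0 T, Real.exp (-(β * t)) * |z t| ≤ M := fun t ht => hmax ht
  have hmon : ∫ t in (0 : ℝ)..s, Real.exp (-(β * t)) * |a t| ≤
      ∫ t in Ioc 0 T, Real.exp (-(β * t)) * |a t| := by
    rw [intervalIntegral.integral_of_le hs.1]
    refine setIntegral_mono_set ?_ (Eventually.of_forall fun t => by positivity)
      (Ioc_subset_Ioc_right hs.2).eventuallyLE
    have habs : IntegrableOn (fun t => |a t|) (Ioc 0 T) := (ha T).abs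
    exact habs.continuousOn_mul_of_subset
      (Continuous.continuousOn (s := Icc 0 T) (by fun_prop)) isCompact_Icc
      measurableSet_Ioc Ioc_subset_Icc_self
  have hint : IntervalIntegrable (fun τ => Real.exp (-(β * (s - τ))) * |a (s - τ)|) volume 0 s :=
    ((intervalIntegrable_reflect hs.1 (ha s)).abs).continuousOn_mul
      (Continuous.continuousOn (by fun_prop))
  have hkey : M ≤ |κ| * ((∫ t in (0 : ℝ)..s, Real.exp (-(β * t)) * |a t|) * M) := by
    have hnorm : |∫ τ in (0 : ℝ)..s, a (s - τ) * z τ| ≤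
        ∫ τ in (0 : ℝ)..s, |a (s - τ) * z τ| :=
      intervalIntegral.abs_integral_le_integral_abs hs.1
    calc M = |κ| * (Real.exp (-(β * s)) * |∫ τ in (0 : ℝ)..s, a (s - τ) * z τ|) := by
            rw [hM, hzeq s hs.1, abs_mul, abs_neg]; ring
      _ ≤ |κ| * (Real.exp (-(β * s)) * ∫ τ in (0 : ℝ)..s, |a (s - τ) * z τ|) := by gcongr
      _ = |κ| * ∫ τ in (0 : ℝ)..s, Real.exp (-(β * s)) * |a (s - τ) * z τ| := by
            rw [intervalIntegral.integral_const_mul]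
      _ ≤ |κ| * ∫ τ in (0 : ℝ)..s, Real.exp (-(β * (s - τ))) * |a (s - τ)| * M := by
            gcongr
            refine intervalIntegral.integral_mono_on hs.1 ?_ (hint.mul_const M) fun τ hτ => ?_
            · exact ((intervalIntegrable_reflect_mul hs.1 (ha s)
                (hzc.mono Icc_subset_Ici_self)).abs).const_mul _
            · have e : Real.exp (-(β * s)) = Real.exp (-(β * (s - τ))) * Real.exp (-(β * τ)) := by
                rw [← Real.exp_add]; ring_nf
              rw [e, abs_mul]
              have := mul_le_mul_of_nonneg_left (hbound τ ⟨hτ.1, hτ.2.trans hs.2⟩)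
                (show 0 ≤ Real.exp (-(β * (s - τ))) * |a (s - τ)| by positivity)
              linarith
      _ = _ := by
            rw [intervalIntegral.integral_mul_const,
              intervalIntegral.integral_comp_sub_left (fun t => Real.exp (-(β * t)) * |a t|) s]
            simp
  have hM' : M = 0 := by
    have := mul_le_mul_of_nonneg_left hmon (abs_nonneg κ)
    by_contra hne
    have hpos : 0 < M := lt_of_le_of_ne hM0 (Ne.symm hne)
    nlinarith
  have h0 := hbound T ⟨hT, le_rfl⟩
  rw [hM'] at h0
  have : |z T| ≤ 0 := by
    by_contra hc
    have := mul_pos (Real.exp_pos (-(β * T))) (not_le.1 hc)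
    linarith
  have := abs_nonpos_iff.1 this
  exact sub_eq_zero.1 this

/-- `1 * (a * r) = a * (1 * r)` for convolution on the half line. -/
theorem integral_convolution_eq_convolution_integral {a r : ℝ → ℝ} {t : ℝ} (ht : 0 ≤ t)
    (ha : IntegrableOn a (Ioc 0 t)) (hr : IntegrableOn r (Ioc 0 t)) :
    IntervalIntegrable (fun s => ∫ τ in (0 : ℝ)..s, a (s - τ) * r τ) volume 0 t ∧
    ∫ s in (0 : ℝ)..t, ∫ τ in (0 : ℝ)..s, a (s - τ) * r τ =
      ∫ τ in (0 : ℝ)..t, a (t - τ) * ∫ σ in (0 : ℝ)..τ, r σ := by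
  set A : ℝ → ℝ := (Icc 0 t).indicator a with hA
  set R : ℝ → ℝ := (Ioc 0 t).indicator r with hR
  have hAi : Integrable A := (integrable_indicator_iff measurableSet_Icc).2 ((integrableOn_Icc_iff_integrableOn_Ioc).2 ha)
  have hRi : Integrable R := (integrable_indicator_iff measurableSet_Ioc).2 hr
  set I : ℝ → ℝ := (Iic t).indicator 1 with hI
  -- the integrand on the triangle, in the variables `(s, τ)`
  have hconv : Integrable (fun p : ℝ × ℝ => R p.2 * A (p.1 - p.2)) (volume.prod volume) := by
    simpa using Integrable.convolution_integrand (ContinuousLinearMap.mul ℝ ℝ) hRi hAi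
  have hImeas : Measurable I := measurable_one.indicator measurableSet_Iic
  have hIle : ∀ x, ‖I x‖ ≤ 1 := fun x => by
    simp only [hI, indicator]; split_ifs <;> simp
  have h₁ : Integrable (fun p : ℝ × ℝ => I p.1 * (R p.2 * A (p.1 - p.2)))
      (volume.prod volume) :=
    hconv.bdd_mul (c := 1) (hImeas.comp measurable_fst).aestronglyMeasurable
      (Eventually.of_forall fun p => hIle p.1)
  have h₂ : Integrable (fun p : ℝ × ℝ => I (p.1 + p.2) * (R p.1 * A p.2))
      (volume.prod volume) :=
    (hRi.mul_prod hAi).bdd_mul (c := 1)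
      (hImeas.comp (measurable_fst.add measurable_snd)).aestronglyMeasurable
      (Eventually.of_forall fun p => hIle _)
  have hinner : ∀ s ∈ Ioc 0 t, ∫ τ in (0 : ℝ)..s, a (s - τ) * r τ =
      ∫ τ, I s * (R τ * A (s - τ)) := fun s hs => by
    rw [intervalIntegral.integral_of_le hs.1.le, ← integral_indicator measurableSet_Ioc]
    congr 1 with τ
    simp only [hI, hR, hA, indicator, mem_Ioc, mem_Icc, mem_Iic, hs.2, Pi.one_apply, if_true,
      one_mul]
    by_cases h : 0 < τ ∧ τ ≤ s
    · rw [if_pos h, if_pos ⟨h.1, h.2.trans hs.2⟩, if_pos ⟨by linarith, by linarith [hs.2]⟩,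
        mul_comm]
    · rw [if_neg h]
      split_ifs with h₁ h₂ <;> simp
      exact absurd ⟨h₁.1, by linarith⟩ h
  have hzero : ∀ s ∉ Ioc 0 t, ∫ τ, I s * (R τ * A (s - τ)) = 0 := fun s hs => by
    rw [← integral_zero ℝ ℝ]
    congr 1 with τ
    simp only [hI, hR, hA, indicator, mem_Ioc, mem_Icc, mem_Iic, Pi.one_apply]
    split_ifs with h₁ h₂ h₃ <;> simp
    exact absurd ⟨by linarith, h₁⟩ hs
  have houter : ∀ σ ∈ Icc 0 t, a σ * ∫ τ in (0 : ℝ)..(t - σ), r τ =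
      ∫ τ, I (σ + τ) * (R τ * A σ) := fun σ hσ => by
    rw [intervalIntegral.integral_of_le (by linarith [hσ.2]), ← integral_indicator measurableSet_Ioc,
      ← integral_const_mul]
    congr 1 with τ
    simp only [hI, hR, hA, indicator, mem_Ioc, mem_Icc, mem_Iic, Pi.one_apply]
    rw [if_pos (show 0 ≤ σ ∧ σ ≤ t from hσ)]
    by_cases h : 0 < τ ∧ τ ≤ t - σ
    · rw [if_pos h, if_pos (by linarith), if_pos ⟨h.1, by linarith [hσ.1]⟩]
      ring
    · rw [if_neg h]
      split_ifs with h₁ h₂ <;> simp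
      exact absurd ⟨h₂.1, by linarith⟩ h
  have houter0 : ∀ σ ∉ Icc 0 t, ∫ τ, I (σ + τ) * (R τ * A σ) = 0 := fun σ hσ => by
    simp [hA, indicator_of_notMem hσ]
  refine ⟨?_, ?_⟩
  · rw [intervalIntegrable_iff_integrableOn_Ioc_of_le ht]
    refine (h₁.integral_prod_left.integrableOn (s := Ioc 0 t)).congr ?_
    filter_upwards [ae_restrict_mem measurableSet_Ioc] with s hs
    exact (hinner s hs).symm
  · calc ∫ s in (0 : ℝ)..t, ∫ τ in (0 : ℝ)..s, a (s - τ) * r τ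
        = ∫ s in Ioc 0 t, ∫ τ, I s * (R τ * A (s - τ)) := by
          rw [intervalIntegral.integral_of_le ht]
          exact setIntegral_congr_fun measurableSet_Ioc hinner
      _ = ∫ s, ∫ τ, I s * (R τ * A (s - τ)) :=
          setIntegral_eq_integral_of_forall_compl_eq_zero hzero
      _ = ∫ τ, ∫ s, I s * (R τ * A (s - τ)) := integral_integral_swap h₁
      _ = ∫ τ, ∫ σ, I (σ + τ) * (R τ * A σ) := by
          congr 1 with τ
          rw [← integral_add_right_eq_self _ τ]
          simp
      _ = ∫ σ, ∫ τ, I (σ + τ) * (R τ * A σ) := by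
          refine integral_integral_swap ?_
          convert h₂ using 1
          ext p
          simp only [Function.uncurry, add_comm]
      _ = ∫ σ in Icc 0 t, ∫ τ, I (σ + τ) * (R τ * A σ) :=
          (setIntegral_eq_integral_of_forall_compl_eq_zero houter0).symm
      _ = ∫ σ in Icc 0 t, a σ * ∫ τ in (0 : ℝ)..(t - σ), r τ :=
          (setIntegral_congr_fun measurableSet_Icc houter).symm
      _ = ∫ σ in (0 : ℝ)..t, a σ * ∫ τ in (0 : ℝ)..(t - σ), r τ := by
          rw [integral_Icc_eq_integral_Ioc, intervalIntegral.integral_of_le ht]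
      _ = _ := by
          have := intervalIntegral.integral_comp_sub_left (a := 0) (b := t)
            (fun τ => a (t - τ) * ∫ σ in (0 : ℝ)..τ, r σ) t
          simpa using this

theorem integrableOn_Ioc_of_locallyIntegrableOn {a : ℝ → ℝ} (ha : LocallyIntegrableOn a (Ici 0))
    (t : ℝ) : IntegrableOn a (Ioc 0 t) :=
  (ha.integrableOn_compact_subset Icc_subset_Ici_self isCompact_Icc).mono_set Ioc_subset_Icc_self

/-- `1 - θ ∫₀ᵗ r` solves the relaxation equation: convolve `r + θ a * r = a` with `1`. -/
theorem IsIntegratedResolvent.isRelaxation {a r : ℝ → ℝ} {θ : ℝ}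
    (ha : ∀ t, IntegrableOn a (Ioc 0 t)) (h : IsIntegratedResolvent a θ r) :
    IsRelaxation a θ fun t => 1 - θ * ∫ τ in (0 : ℝ)..t, r τ := by
  have hr := integrableOn_Ioc_of_locallyIntegrableOn h.1
  have hcont : ContinuousOn (fun t => ∫ τ in (0 : ℝ)..t, r τ) (Ici 0) := by
    intro t ht
    have hc : ContinuousOn (fun t => ∫ τ in (0 : ℝ)..t, r τ) (Icc 0 (t + 1)) :=
      intervalIntegral.continuousOn_primitive_interval'
        ((intervalIntegrable_iff_integrableOn_Ioc_of_le (by linarith [mem_Ici.1 ht])).2 (hr (t + 1)))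
        left_mem_uIcc |>.mono (uIcc_of_le (by linarith [mem_Ici.1 ht])).ge
    refine (hc t ⟨ht, by linarith⟩).mono_of_mem_nhdsWithin ?_
    rw [← Ici_inter_Iic]
    exact inter_mem_nhdsWithin _ (Iic_mem_nhds (by linarith))
  refine ⟨by fun_prop, fun t ht => ?_⟩
  obtain ⟨hi, he⟩ := integral_convolution_eq_convolution_integral ht (ha t) (hr t)
  have har : IntervalIntegrable (fun τ => a (t - τ)) volume 0 t :=
    intervalIntegrable_reflect ht (ha t)
  have hmul := intervalIntegrable_reflect_mul ht (ha t) (hcont.mono Icc_subset_Ici_self)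
  have hri : IntervalIntegrable r volume 0 t :=
    (intervalIntegrable_iff_integrableOn_Ioc_of_le ht).2 (hr t)
  have e₁ : ∫ τ in (0 : ℝ)..t, a (t - τ) * (1 - θ * ∫ σ in (0 : ℝ)..τ, r σ) =
      (∫ τ in (0 : ℝ)..t, a τ) - θ * ∫ τ in (0 : ℝ)..t, a (t - τ) * ∫ σ in (0 : ℝ)..τ, r σ := by
    rw [← intervalIntegral.integral_const_mul]
    have hrefl : ∫ τ in (0 : ℝ)..t, a τ = ∫ τ in (0 : ℝ)..t, a (t - τ) := by
      simp
    rw [hrefl, ← intervalIntegral.integral_sub har (hmul.const_mul θ)]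
    congr 1 with τ
    ring
  have e₂ : (∫ τ in (0 : ℝ)..t, r τ) +
      θ * ∫ s in (0 : ℝ)..t, ∫ τ in (0 : ℝ)..s, a (s - τ) * r τ = ∫ τ in (0 : ℝ)..t, a τ := by
    rw [← intervalIntegral.integral_const_mul, ← intervalIntegral.integral_add hri (hi.const_mul θ),
      intervalIntegral.integral_of_le ht, intervalIntegral.integral_of_le ht]
    exact integral_congr_ae (ae_restrict_of_ae_restrict_of_subset Ioc_subset_Ioi_self h.2)
  rw [e₁, ← he, ← e₂]
  ring

/-! ### The relaxation function -/

namespace ConditionM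

variable {m : ℝ → ℝ} {lam : ℝ}

theorem kernel_integrableOn (hm : ConditionM m) (t : ℝ) :
    IntegrableOn (fun t => 1 + m t) (Ioc 0 t) :=
  (integrableOn_const (by simp)).add (integrableOn_Ioc_of_locallyIntegrableOn hm.locInt t)

theorem isRelaxation (hm : ConditionM m) (hlam : 0 < lam) :
    IsRelaxation (fun t => 1 + m t) lam (fun t => relaxation m t lam) := by
  obtain ⟨w, hw, -⟩ := (hm.completelyPositive lam hlam).1
  exact Classical.epsilon_spec (p := IsRelaxation (fun t => 1 + m t) lam) ⟨w, hw⟩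

theorem relaxation_continuousOn (hm : ConditionM m) (hlam : 0 < lam) :
    ContinuousOn (fun t => relaxation m t lam) (Ici 0) := (hm.isRelaxation hlam).1

theorem relaxation_nonneg (hm : ConditionM m) (hlam : 0 < lam) {t : ℝ} (ht : 0 ≤ t) :
    0 ≤ relaxation m t lam := by
  obtain ⟨w, hw, hw0⟩ := (hm.completelyPositive lam hlam).1
  have := (hm.isRelaxation hlam).eqOn hm.kernel_integrableOn hw (show t ∈ Ici 0 from ht)
  simp only at this
  exact this ▸ hw0 t ht

/-- `ω = 1 - λ ∫ r` with `r ≥ 0`. -/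
theorem relaxation_antitoneOn (hm : ConditionM m) (hlam : 0 < lam) :
    AntitoneOn (fun t => relaxation m t lam) (Ici 0) := by
  obtain ⟨r, hr, hr0⟩ := (hm.completelyPositive lam hlam).2
  have heq := (hm.isRelaxation hlam).eqOn hm.kernel_integrableOn
    (hr.isRelaxation hm.kernel_integrableOn)
  intro s hs t ht hst
  rw [heq hs, heq ht]
  have hle : ∫ τ in (0 : ℝ)..s, r τ ≤ ∫ τ in (0 : ℝ)..t, r τ := by
    rw [intervalIntegral.integral_of_le hs, intervalIntegral.integral_of_le ht]
    exact setIntegral_mono_set (integrableOn_Ioc_of_locallyIntegrableOn hr.1 t)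
      (ae_restrict_of_ae_restrict_of_subset Ioc_subset_Ioi_self hr0)
      (Ioc_subset_Ioc_right hst).eventuallyLE
  have := mul_le_mul_of_nonneg_left hle hlam.le
  simp only
  linarith

theorem relaxation_le_one (hm : ConditionM m) (hlam : 0 < lam) {t : ℝ} (ht : 0 ≤ t) :
    relaxation m t lam ≤ 1 := by
  have h0 := (hm.isRelaxation hlam).2 0 le_rfl
  have := hm.relaxation_antitoneOn hlam self_mem_Ici (show t ∈ Ici 0 from ht) ht
  simp at h0 this
  linarith

theorem relaxation_intervalIntegrable (hm : ConditionM m) (hlam : 0 < lam) {t : ℝ} (ht : 0 ≤ t) :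
    IntervalIntegrable (fun τ => relaxation m τ lam) volume 0 t :=
  ((hm.relaxation_continuousOn hlam).mono Icc_subset_Ici_self).intervalIntegrable_of_Icc ht

/-- Since `m ≥ 0` and `ω ≥ 0`, the equation gives `λ ∫₀ᵗ ω ≤ 1 - ω(t)`. -/
theorem mul_integral_relaxation_le_one (hm : ConditionM m) (hlam : 0 < lam) {t : ℝ} (ht : 0 ≤ t) :
    lam * ∫ τ in (0 : ℝ)..t, relaxation m τ lam ≤ 1 := by
  have heq := (hm.isRelaxation hlam).2 t ht
  have hle : ∫ τ in (0 : ℝ)..t, relaxation m τ lam ≤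
      ∫ τ in (0 : ℝ)..t, (1 + m (t - τ)) * relaxation m τ lam := by
    refine intervalIntegral.integral_mono_ae_restrict ht (hm.relaxation_intervalIntegrable hlam ht)
      (intervalIntegrable_reflect_mul ht (hm.kernel_integrableOn t)
        ((hm.relaxation_continuousOn hlam).mono Icc_subset_Ici_self)) ?_
    have hpos : ∀ᵐ s : ℝ, 0 < s → 0 ≤ m s := (ae_restrict_iff' measurableSet_Ioi).1 hm.nonneg
    have hpos' : ∀ᵐ τ : ℝ, 0 < t - τ → 0 ≤ m (t - τ) :=
      (quasiMeasurePreserving_sub_left volume t).ae hpos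
    have hne : ∀ᵐ τ : ℝ, τ ≠ t := by simp [ae_iff]
    rw [EventuallyLE, ae_restrict_iff' measurableSet_Icc]
    filter_upwards [hpos', hne] with τ hτ hτt hmem
    have h1 := hτ (sub_pos.2 (lt_of_le_of_ne hmem.2 hτt))
    have h2 := hm.relaxation_nonneg hlam hmem.1
    nlinarith
  have := mul_le_mul_of_nonneg_left hle hlam.le
  have := hm.relaxation_nonneg hlam ht
  linarith

theorem mul_mul_relaxation_le_one (hm : ConditionM m) (hlam : 0 < lam) {t : ℝ} (ht : 0 ≤ t) :
    lam * t * relaxation m t lam ≤ 1 := by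
  refine le_trans ?_ (hm.mul_integral_relaxation_le_one hlam ht)
  rw [mul_assoc]
  gcongr
  have : ∫ τ in (0 : ℝ)..t, relaxation m t lam ≤ ∫ τ in (0 : ℝ)..t, relaxation m τ lam :=
    intervalIntegral.integral_mono_on ht intervalIntegrable_const
      (hm.relaxation_intervalIntegrable hlam ht) fun τ hτ =>
        hm.relaxation_antitoneOn hlam (show τ ∈ Ici 0 from hτ.1) (show t ∈ Ici 0 from ht) hτ.2
  simpa using this

/-- Interpolation between `ω ≤ 1` and `λ t ω(t) ≤ 1`. -/
theorem rpow_mul_relaxation_le (hm : ConditionM m) (hlam : 0 < lam) {t p : ℝ} (ht : 0 < t)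
    (hp : 0 ≤ p) (hp1 : p ≤ 1) : lam ^ p * relaxation m t lam ≤ t ^ (-p) := by
  have h0 := hm.relaxation_nonneg hlam ht.le
  have h1 : relaxation m t lam ≤ relaxation m t lam ^ p :=
    Real.self_le_rpow_of_le_one h0 (hm.relaxation_le_one hlam ht.le) hp1
  have h2 : (lam * t * relaxation m t lam) ^ p ≤ 1 :=
    Real.rpow_le_one (by positivity) (hm.mul_mul_relaxation_le_one hlam ht.le) hp
  rw [Real.mul_rpow (by positivity) h0, Real.mul_rpow hlam.le ht.le] at h2
  rw [Real.rpow_neg ht.le, ← one_div, le_div_iff₀ (by positivity)]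
  have := mul_le_mul_of_nonneg_left h1 (show 0 ≤ lam ^ p * t ^ p by positivity)
  linarith

end ConditionM

/-! ### Coordinates in the Hilbert scale -/

namespace DirichletEigenbasis

variable {d : ℕ} {Ω : BoundedDomain d} {E : DirichletEigenbasis Ω} {s : ℝ}

theorem H.summable_toSeq_sq (φ : E.H s) : Summable fun n => H.toSeq E s φ n ^ 2 := φ.2

theorem toSeq_eigen (n : ℕ) :
    H.toSeq E s (E.eigen s n) = lp.single 2 n (E.lam n ^ (s / 2)) := by
  ext k
  change E.lam k ^ (s / 2) * ⟪E.e n, E.e k⟫ = _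
  rcases eq_or_ne k n with rfl | hk
  · rw [real_inner_self_eq_norm_sq, E.e.orthonormal.1]
    simp
  · rw [E.e.orthonormal.2 hk.symm]
    simp [hk]

variable [NeZero d]

theorem H.norm_sq_eq_tsum_toSeq (φ : E.H s) : ‖φ‖ ^ 2 = ∑' n, H.toSeq E s φ n ^ 2 := H.norm_sq φ

/-- The `n`-th coordinate `λₙ^{s/2} (φ, eₙ)` as a continuous functional on `ℍ^s`. -/
noncomputable def H.coord (E : DirichletEigenbasis Ω) (s : ℝ) (n : ℕ) : E.H s →L[ℝ] ℝ :=
  LinearMap.mkContinuous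
    { toFun := fun φ => H.toSeq E s φ n
      map_add' := fun φ ψ => by simp
      map_smul' := fun c φ => by simp } 1 fun φ => by
    rw [one_mul]
    exact lp.norm_apply_le_norm (by norm_num) (H.toSeq E s φ) n

theorem H.coord_apply (n : ℕ) (φ : E.H s) : H.coord E s n φ = H.toSeq E s φ n := rfl

theorem H.ext_toSeq {φ ψ : E.H s} (h : ∀ n, H.toSeq E s φ n = H.toSeq E s ψ n) : φ = ψ := by
  apply H.toSeq_injective
  ext n
  exact h n

/-- Synthesis: a square summable family of coordinates defines an element of `ℍ^s`. -/
theorem toSeq_tsum_smul_eigen (hs : 0 ≤ s) {c : ℕ → ℝ}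
    (hc : Summable fun n => (E.lam n ^ (s / 2) * c n) ^ 2) (n : ℕ) :
    H.toSeq E s (∑' k, c k • E.eigen s k) n = E.lam n ^ (s / 2) * c n := by
  let a : lp (fun _ : ℕ => ℝ) 2 := ⟨fun n => E.lam n ^ (s / 2) * c n, H.memlp_two hc⟩
  have ha : HasSum (fun k => lp.single 2 k (a k)) a := lp.hasSum_single (by norm_num) a
  have h := ha.mapL (H.seqEquiv (E := E) hs).symm.toContinuousLinearEquiv.toContinuousLinearMap
  have hterm : ∀ k, (H.seqEquiv hs).symm (lp.single 2 k (a k)) = c k • E.eigen s k := fun k => by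
    rw [LinearIsometryEquiv.symm_apply_eq]
    change _ = H.toSeq E s (c k • E.eigen s k)
    rw [map_smul, toSeq_eigen, ← lp.single_smul]
    congr 1
    exact mul_comm _ _
  have h' : HasSum (fun k => c k • E.eigen s k) ((H.seqEquiv hs).symm a) := by
    convert h using 1
    · ext1 k
      exact (hterm k).symm
    · rfl
  rw [h'.tsum_eq]
  change (H.seqEquiv hs ((H.seqEquiv hs).symm a)) n = _
  rw [LinearIsometryEquiv.apply_symm_apply]

theorem norm_sq_le_of_toSeq {φ : E.H s} {c b : ℕ → ℝ} {C : ℝ}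
    (hφ : ∀ n, H.toSeq E s φ n = c n * b n) (hc : ∀ n, |c n| ≤ C)
    (hb : Summable fun n => b n ^ 2) : ‖φ‖ ^ 2 ≤ C ^ 2 * ∑' n, b n ^ 2 := by
  rw [H.norm_sq_eq_tsum_toSeq, ← tsum_mul_left]
  refine (H.summable_toSeq_sq φ).tsum_le_tsum (fun n => ?_) (hb.mul_left _)
  rw [hφ, mul_pow]
  exact mul_le_mul_of_nonneg_right (sq_le_sq' (abs_le.1 (hc n)).1 (abs_le.1 (hc n)).2)
    (sq_nonneg _)

/-- Coordinatewise convergence of uniformly bounded multipliers implies strong convergence. -/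
theorem tendsto_of_toSeq {ι : Type*} {l : Filter ι} {U : ι → E.H s} {U₀ : E.H s}
    {c : ι → ℕ → ℝ} {c₀ b : ℕ → ℝ} {C : ℝ}
    (hU : ∀ᶠ x in l, ∀ n, H.toSeq E s (U x) n = c x n * b n)
    (hU₀ : ∀ n, H.toSeq E s U₀ n = c₀ n * b n)
    (hc : ∀ᶠ x in l, ∀ n, |c x n| ≤ C) (hc₀ : ∀ n, |c₀ n| ≤ C)
    (hlim : ∀ n, Tendsto (fun x => c x n) l (𝓝 (c₀ n)))
    (hb : Summable fun n => b n ^ 2) : Tendsto U l (𝓝 U₀) := by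
  have hlim' : Tendsto (fun x => ∑' n, ((c x n - c₀ n) * b n) ^ 2) l (𝓝 (∑' _ : ℕ, (0 : ℝ))) := by
    refine tendsto_tsum_of_dominated_convergence (hb.mul_left ((2 * C) ^ 2)) (fun n => ?_) ?_
    · have := (((hlim n).sub_const (c₀ n)).mul_const (b n)).pow 2
      simpa using this
    · filter_upwards [hc] with x hx n
      rw [Real.norm_eq_abs, abs_of_nonneg (sq_nonneg _), mul_pow]
      have h := (abs_sub (c x n) (c₀ n)).trans (add_le_add (hx n) (hc₀ n))
      refine mul_le_mul_of_nonneg_right (sq_le_sq' ?_ ?_) (sq_nonneg _) <;>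
        linarith [abs_le.1 h]
  rw [tendsto_iff_norm_sub_tendsto_zero]
  have hsq : Tendsto (fun x => ‖U x - U₀‖ ^ 2) l (𝓝 0) := by
    rw [tsum_zero] at hlim'
    refine hlim'.congr' ?_
    filter_upwards [hU] with x hx
    rw [H.norm_sq_eq_tsum_toSeq]
    congr 1 with n
    rw [map_sub, lp.coeFn_sub, Pi.sub_apply, hx, hU₀, sub_mul]
  have := hsq.sqrt
  simpa [Real.sqrt_sq] using this

/-! ### The resolvent family -/

section Resolvent

variable {m : ℝ → ℝ} {μ θ : ℝ}

theorem abs_relaxation_le_one (hm : ConditionM m) {t : ℝ} (ht : 0 ≤ t) (n : ℕ) :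
    |relaxation m t (E.lam n)| ≤ 1 := by
  rw [abs_of_nonneg (hm.relaxation_nonneg (E.lam_pos n) ht)]
  exact hm.relaxation_le_one (E.lam_pos n) ht

theorem toSeq_resolvent (hm : ConditionM m) (hμ : 0 ≤ μ) {t : ℝ} (ht : 0 ≤ t) (ξ : E.H μ) (n : ℕ) :
    H.toSeq E μ (E.resolvent m μ t ξ) n = relaxation m t (E.lam n) * H.toSeq E μ ξ n := by
  rw [resolvent, toSeq_tsum_smul_eigen hμ, H.toSeq_apply]
  · ring
  · refine Summable.of_nonneg_of_le (fun _ => sq_nonneg _) (fun n => ?_) (H.summable_toSeq_sq ξ)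
    rw [H.toSeq_apply, mul_left_comm, mul_pow]
    refine mul_le_of_le_one_left (sq_nonneg _) ?_
    rw [sq_le_one_iff_abs_le_one]
    exact abs_relaxation_le_one hm ht n

theorem norm_resolvent_le (hm : ConditionM m) (hμ : 0 ≤ μ) {t : ℝ} (ht : 0 ≤ t) (ξ : E.H μ) :
    ‖E.resolvent m μ t ξ‖ ≤ ‖ξ‖ := by
  have h := norm_sq_le_of_toSeq (toSeq_resolvent hm hμ ht ξ) (abs_relaxation_le_one hm ht)
    (H.summable_toSeq_sq ξ)
  rw [← H.norm_sq_eq_tsum_toSeq, one_pow, one_mul] at h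
  exact le_of_sq_le_sq h (norm_nonneg _)

theorem continuousOn_resolvent (hm : ConditionM m) (hμ : 0 ≤ μ) (ξ : E.H μ) :
    ContinuousOn (fun t => E.resolvent m μ t ξ) (Ici 0) := fun t₀ ht₀ =>
  tendsto_of_toSeq (C := 1) (c := fun t n => relaxation m t (E.lam n))
    (by filter_upwards [self_mem_nhdsWithin] with t ht using toSeq_resolvent hm hμ ht ξ)
    (toSeq_resolvent hm hμ ht₀ ξ)
    (by filter_upwards [self_mem_nhdsWithin] with t ht using abs_relaxation_le_one hm ht)
    (abs_relaxation_le_one hm ht₀)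
    (fun n => hm.relaxation_continuousOn (E.lam_pos n) t₀ ht₀)
    (H.summable_toSeq_sq ξ)

/-- The coordinates of a functional are square summable. -/
theorem HNeg.summable_sq (hθ : 0 ≤ θ) (F : E.HNeg θ) :
    Summable fun n => (E.lam n ^ (-(θ / 2)) * F (E.eigen θ n)) ^ 2 := by
  by_contra hns
  have h := HNeg.norm_sq hθ F
  -- the sum of a divergent series is zero by convention, which forces `F = 0`
  rw [tsum_eq_zero_of_not_summable hns] at h
  have hF : F = 0 := norm_eq_zero.1 (pow_eq_zero_iff (two_ne_zero) |>.1 h)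
  exact hns (by simp [hF])

theorem abs_smoothing_le (hm : ConditionM m) (hμ : 0 ≤ μ) (hθ : 0 ≤ θ) (hμθ : μ + θ ≤ 2) {t : ℝ}
    (ht : 0 < t) (n : ℕ) :
    |E.lam n ^ ((μ + θ) / 2) * relaxation m t (E.lam n)| ≤ t ^ (-((μ + θ) / 2)) := by
  have h0 := hm.relaxation_nonneg (E.lam_pos n) ht.le
  have h1 := (E.lam_pos n).le
  rw [abs_of_nonneg (by positivity)]
  exact hm.rpow_mul_relaxation_le (E.lam_pos n) ht (by linarith) (by linarith)

theorem toSeq_resolventNeg (hm : ConditionM m) (hμ : 0 ≤ μ) (hθ : 0 ≤ θ) (hμθ : μ + θ ≤ 2) {t : ℝ}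
    (ht : 0 < t) (F : E.HNeg θ) (n : ℕ) :
    H.toSeq E μ (E.resolventNeg m θ μ t F) n =
      (E.lam n ^ ((μ + θ) / 2) * relaxation m t (E.lam n)) *
        (E.lam n ^ (-(θ / 2)) * F (E.eigen θ n)) := by
  have hsplit : ∀ n, E.lam n ^ (μ / 2) * (relaxation m t (E.lam n) * F (E.eigen θ n)) =
      (E.lam n ^ ((μ + θ) / 2) * relaxation m t (E.lam n)) *
        (E.lam n ^ (-(θ / 2)) * F (E.eigen θ n)) := fun n => by
    rw [show μ / 2 = (μ + θ) / 2 + -(θ / 2) by ring, Real.rpow_add (E.lam_pos n)]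
    ring
  rw [resolventNeg, toSeq_tsum_smul_eigen hμ, hsplit]
  refine Summable.of_nonneg_of_le (fun _ => sq_nonneg _) (fun n => ?_)
    ((HNeg.summable_sq hθ F).mul_left ((t ^ (-((μ + θ) / 2))) ^ 2))
  have h := abs_le.1 (abs_smoothing_le (E := E) hm hμ hθ hμθ ht n)
  rw [hsplit, mul_pow (_ * relaxation m t (E.lam n))]
  exact mul_le_mul_of_nonneg_right (sq_le_sq' h.1 h.2) (sq_nonneg _)

theorem norm_resolventNeg_le (hm : ConditionM m) (hμ : 0 ≤ μ) (hθ : 0 ≤ θ) (hμθ : μ + θ ≤ 2)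
    {t : ℝ} (ht : 0 < t) (F : E.HNeg θ) :
    ‖E.resolventNeg m θ μ t F‖ ≤ t ^ (-((μ + θ) / 2)) * ‖F‖ := by
  have h := norm_sq_le_of_toSeq (toSeq_resolventNeg hm hμ hθ hμθ ht F)
    (abs_smoothing_le hm hμ hθ hμθ ht) (HNeg.summable_sq hθ F)
  rw [← HNeg.norm_sq hθ, ← mul_pow] at h
  exact le_of_sq_le_sq h (by positivity)

theorem resolventNeg_sub (hm : ConditionM m) (hμ : 0 ≤ μ) (hθ : 0 ≤ θ) (hμθ : μ + θ ≤ 2)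
    {t : ℝ} (ht : 0 < t) (F F' : E.HNeg θ) :
    E.resolventNeg m θ μ t (F - F') = E.resolventNeg m θ μ t F - E.resolventNeg m θ μ t F' := by
  refine H.ext_toSeq fun n => ?_
  rw [map_sub, lp.coeFn_sub, Pi.sub_apply]
  simp only [toSeq_resolventNeg hm hμ hθ hμθ ht, sub_apply]
  ring

theorem continuousOn_resolventNeg (hm : ConditionM m) (hμ : 0 ≤ μ) (hθ : 0 ≤ θ) (hμθ : μ + θ ≤ 2)
    (F : E.HNeg θ) : ContinuousOn (fun t => E.resolventNeg m θ μ t F) (Ioi 0) := by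
  intro t₀ ht₀
  rw [mem_Ioi] at ht₀
  have hle : ∀ t, t₀ / 2 ≤ t → t ^ (-((μ + θ) / 2)) ≤ (t₀ / 2) ^ (-((μ + θ) / 2)) := fun t ht =>
    Real.rpow_le_rpow_of_nonpos (by positivity) ht (by linarith)
  refine tendsto_of_toSeq (C := (t₀ / 2) ^ (-((μ + θ) / 2)))
    (c := fun t n => E.lam n ^ ((μ + θ) / 2) * relaxation m t (E.lam n))
    (by filter_upwards [self_mem_nhdsWithin] with t ht using toSeq_resolventNeg hm hμ hθ hμθ ht F)
    (toSeq_resolventNeg hm hμ hθ hμθ ht₀ F) ?_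
    (fun n => (abs_smoothing_le hm hμ hθ hμθ ht₀ n).trans (hle t₀ (by linarith)))
    (fun n => ?_) (HNeg.summable_sq hθ F)
  · have : ∀ᶠ t in 𝓝[Ioi 0] t₀, t₀ / 2 < t := nhdsWithin_le_nhds (lt_mem_nhds (by linarith))
    filter_upwards [this] with t ht n
    exact (abs_smoothing_le hm hμ hθ hμθ (by linarith) n).trans (hle t ht.le)
  · exact (((hm.relaxation_continuousOn (E.lam_pos n)).mono Ioi_subset_Ici_self) t₀ ht₀).const_mul _

end Resolvent

end DirichletEigenbasis

/-! ### Volterra equations in Banach spaces -/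

section FixedPoint

variable {X Y : Type*} [NormedAddCommGroup X] [NormedAddCommGroup Y]

/-- A family of additive maps `A σ : Y → X`, `σ ∈ (0, T)`, whose norms are dominated by an integrable
function `k`, and which is measurable along continuous functions. Nothing is asked outside
`(0, T)`. -/
structure IsIntegrableKernel (T : ℝ) (A : ℝ → Y → X) (k : ℝ → ℝ) : Prop where
  integrableOn : IntegrableOn k (Ioo 0 T)
  norm_le : ∀ σ ∈ Ioo 0 T, ∀ y, ‖A σ y‖ ≤ k σ * ‖y‖
  map_sub : ∀ σ ∈ Ioo 0 T, ∀ y y', A σ (y - y') = A σ y - A σ y'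
  measurable : ∀ g : ℝ → Y, Continuous g →
    AEStronglyMeasurable (fun σ => A σ (g σ)) (volume.restrict (Ioo 0 T))

namespace IsIntegrableKernel

variable {T : ℝ} {A : ℝ → Y → X} {k : ℝ → ℝ}

theorem continuous_apply (h : IsIntegrableKernel T A k) {σ : ℝ} (hσ : σ ∈ Ioo 0 T) :
    Continuous (A σ) := by
  rw [continuous_iff_continuousAt]
  intro y
  rw [ContinuousAt, tendsto_iff_norm_sub_tendsto_zero]
  refine squeeze_zero (fun _ => norm_nonneg _)
    (fun z => (h.map_sub σ hσ z y ▸ h.norm_le σ hσ (z - y) : _)) ?_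
  have : Tendsto (fun z => k σ * ‖z - y‖) (𝓝 y) (𝓝 (k σ * ‖y - y‖)) :=
    Continuous.tendsto (by fun_prop) y
  simpa using this

theorem aestronglyMeasurable_comp_sub (h : IsIntegrableKernel T A k) {g : ℝ → Y}
    (hg : Continuous g) (t : ℝ) :
    AEStronglyMeasurable (fun σ => A σ (g (t - σ))) (volume.restrict (Ioo 0 T)) :=
  h.measurable (fun σ => g (t - σ)) (by fun_prop)

theorem intervalIntegrable (h : IsIntegrableKernel T A k) {g : ℝ → Y} (hg : Continuous g)
    {M : ℝ} (hM : ∀ τ, ‖g τ‖ ≤ M) {t : ℝ} (ht : t ∈ Icc 0 T) :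
    IntervalIntegrable (fun τ => A (t - τ) (g τ)) volume 0 t := by
  have h₁ : IntegrableOn (fun σ => A σ (g (t - σ))) (Ioo 0 T) := by
    refine Integrable.mono' (h.integrableOn.norm.mul_const M)
      (h.aestronglyMeasurable_comp_sub hg t) ?_
    filter_upwards [ae_restrict_mem measurableSet_Ioo] with σ hσ
    refine (h.norm_le σ hσ _).trans ?_
    exact mul_le_mul (Real.le_norm_self _) (hM _) (norm_nonneg _) (norm_nonneg _)
  have h₂ : IntervalIntegrable (fun σ => A σ (g (t - σ))) volume 0 t := by
    rw [intervalIntegrable_iff_integrableOn_Ioo_of_le ht.1]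
    exact h₁.mono_set (Ioo_subset_Ioo_right ht.2)
  simpa using (h₂.comp_sub_left t).symm

variable [NormedSpace ℝ X]

theorem norm_integral_le (h : IsIntegrableKernel T A k) {g : ℝ → Y} {M : ℝ} (hM0 : 0 ≤ M) {t : ℝ}
    (ht : t ∈ Icc 0 T) (hM : ∀ τ ∈ Icc 0 t, ‖g τ‖ ≤ M) :
    ‖∫ τ in (0 : ℝ)..t, A (t - τ) (g τ)‖ ≤ (∫ σ in Ioo 0 T, |k σ|) * M := by
  have hkT : IntegrableOn (fun σ => |k σ|) (Ioo 0 T) := h.integrableOn.norm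
  have hk : IntervalIntegrable (fun σ => |k σ|) volume 0 t := by
    rw [intervalIntegrable_iff_integrableOn_Ioo_of_le ht.1]
    exact hkT.mono_set (Ioo_subset_Ioo_right ht.2)
  have hk' : IntervalIntegrable (fun τ => |k (t - τ)|) volume 0 t := by
    simpa using (hk.comp_sub_left t).symm
  calc ‖∫ τ in (0 : ℝ)..t, A (t - τ) (g τ)‖ ≤ ∫ τ in (0 : ℝ)..t, |k (t - τ)| * M := by
        refine intervalIntegral.norm_integral_le_of_norm_le ht.1 ?_ (hk'.mul_const M)
        have hne : ∀ᵐ τ : ℝ, τ ≠ t := by simp [ae_iff]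
        filter_upwards [hne] with τ hne hτ
        have hmem : t - τ ∈ Ioo 0 T :=
          ⟨sub_pos.2 (lt_of_le_of_ne hτ.2 hne), by linarith [hτ.1, ht.2]⟩
        exact (h.norm_le _ hmem _).trans
          (mul_le_mul (le_abs_self _) (hM _ ⟨hτ.1.le, hτ.2⟩) (norm_nonneg _) (abs_nonneg _))
    _ = (∫ σ in Ioo 0 t, |k σ|) * M := by
        rw [intervalIntegral.integral_mul_const,
          intervalIntegral.integral_comp_sub_left (fun σ => |k σ|) t, sub_self, sub_zero,
          intervalIntegral.integral_of_le ht.1, integral_Ioc_eq_integral_Ioo]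
    _ ≤ _ := by
        refine mul_le_mul_of_nonneg_right ?_ hM0
        exact setIntegral_mono_set h.integrableOn.norm (Eventually.of_forall fun _ => abs_nonneg _)
          (Ioo_subset_Ioo_right ht.2).eventuallyLE

/-- Convolution with an integrable kernel preserves continuity. -/
theorem continuousOn_integral (h : IsIntegrableKernel T A k) {g : ℝ → Y} (hg : Continuous g)
    {M : ℝ} (hM : ∀ τ, ‖g τ‖ ≤ M) :
    ContinuousOn (fun t => ∫ τ in (0 : ℝ)..t, A (t - τ) (g τ)) (Icc 0 T) := by
  have hcont : Continuous fun t =>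
      ∫ σ in Ioo 0 T, (Iio t).indicator (fun σ => A σ (g (t - σ))) σ := by
    rw [continuous_iff_continuousAt]
    intro t₀
    refine continuousAt_of_dominated (bound := fun σ => ‖k σ‖ * M)
      (Eventually.of_forall fun t =>
        (h.aestronglyMeasurable_comp_sub hg t).indicator measurableSet_Iio)
      (Eventually.of_forall fun t => ?_) (h.integrableOn.norm.mul_const M) ?_
    · filter_upwards [ae_restrict_mem measurableSet_Ioo] with σ hσ
      refine (norm_indicator_le_norm_self _ _).trans ((h.norm_le σ hσ _).trans ?_)
      exact mul_le_mul (Real.le_norm_self _) (hM _) (norm_nonneg _) (norm_nonneg _)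
    · have hne : ∀ᵐ σ : ℝ, σ ≠ t₀ := by simp [ae_iff]
      filter_upwards [ae_restrict_mem measurableSet_Ioo, ae_restrict_of_ae hne] with σ hσ hσt
      rcases lt_or_gt_of_ne hσt with hlt | hlt
      · have : Continuous fun t => A σ (g (t - σ)) :=
          (h.continuous_apply hσ).comp (by fun_prop)
        refine this.continuousAt.congr ?_
        filter_upwards [lt_mem_nhds hlt] with t ht
        rw [indicator_of_mem (show σ ∈ Iio t from ht)]
      · refine (continuousAt_const (y := (0 : X))).congr ?_
        filter_upwards [gt_mem_nhds hlt] with t ht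
        rw [indicator_of_notMem (show σ ∉ Iio t from not_lt.2 ht.le)]
  refine hcont.continuousOn.congr fun t ht => ?_
  have e := intervalIntegral.integral_comp_sub_left (a := 0) (b := t) (fun σ => A σ (g (t - σ))) t
  simp only [sub_sub_cancel, sub_self, sub_zero] at e
  simp only
  rw [e, intervalIntegral.integral_of_le ht.1, integral_Ioc_eq_integral_Ioo,
    setIntegral_indicator measurableSet_Iio]
  congr 2
  ext σ
  simp only [mem_Ioo, mem_inter_iff, mem_Iio]
  constructor
  · exact fun hσ => ⟨⟨hσ.1, hσ.2.trans_le ht.2⟩, hσ.2⟩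
  · exact fun hσ => ⟨hσ.1.1, hσ.2⟩

/-- Multiplication by an integrable scalar function. -/
theorem smul {ℓ : ℝ → ℝ} (hℓ : IntegrableOn ℓ (Ioo 0 T)) :
    IsIntegrableKernel T (fun σ (x : X) => ℓ σ • x) fun σ => |ℓ σ| where
  integrableOn := hℓ.norm
  norm_le σ _ y := by rw [norm_smul, Real.norm_eq_abs]
  map_sub σ _ y y' := smul_sub _ _ _
  measurable g hg := hℓ.aestronglyMeasurable.smul hg.aestronglyMeasurable

end IsIntegrableKernel

variable [NormedSpace ℝ X]

/-- Solutions of the Volterra equation `u(t) = z(t) + ∫₀ᵗ R(t - τ) f(u(τ), (ℓ * u)(τ)) dτ` in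
`C([0, T]; X)`. -/
def IsVolterraSolution (T : ℝ) (R : ℝ → Y → X) (ℓ : ℝ → ℝ) (f : X → X → Y) (z u : ℝ → X) : Prop :=
  ContinuousOn u (Icc 0 T) ∧ ∀ t ∈ Icc 0 T,
    u t = z t + ∫ τ in (0 : ℝ)..t, R (t - τ) (f (u τ) (∫ σ in (0 : ℝ)..τ, ℓ (τ - σ) • u σ))

theorem continuous_IccExtend {Z : Type*} [TopologicalSpace Z] {a b : ℝ} (h : a ≤ b)
    (u : C(Icc a b, Z)) : Continuous (IccExtend h u) :=
  u.continuous.Icc_extend'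

theorem norm_IccExtend_le {Z : Type*} [NormedAddCommGroup Z] {a b : ℝ} (h : a ≤ b)
    (u : C(Icc a b, Z)) (τ : ℝ) : ‖IccExtend h u τ‖ ≤ ‖u‖ :=
  u.norm_coe_le_norm _

/-- Banach's fixed point theorem for `u ↦ z + R * f(u, ℓ * u)` on a ball of `C([0, T]; X)`. The
constant `C` bounds convolution with `R` from `C([0, T]; Y)` to `C([0, T]; X)`; it may be better than
the `L¹` norm of `k`, which only serves to make the integrals converge and depend continuously on
the time. With contraction constant `1 / 2`, free terms in the ball of half the radius are
admissible. -/
theorem exists_unique_volterraSolution [CompleteSpace X] {T : ℝ} (hT : 0 < T)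
    {R : ℝ → Y → X} {k : ℝ → ℝ} (hR : IsIntegrableKernel T R k)
    {ℓ : ℝ → ℝ} (hℓ : IntegrableOn ℓ (Ioo 0 T)) {C : ℝ}
    (hC : ∀ t ∈ Icc 0 T, ∀ g : ℝ → Y, Continuous g → ∀ M, (∀ τ, ‖g τ‖ ≤ M) →
      ‖∫ τ in (0 : ℝ)..t, R (t - τ) (g τ)‖ ≤ C * M)
    {f : X → X → Y} (hfc : Continuous fun p : X × X => f p.1 p.2) (hf0 : f 0 0 = 0)
    {ρ ρ' l κ : ℝ} (hρ : 0 < ρ) (hl : 0 ≤ l) (hκ : 0 ≤ κ)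
    (hρ' : ρ * (∫ σ in Ioo 0 T, |ℓ σ|) ≤ ρ')
    (hf : ∀ v₁ v₂ w₁ w₂ : X, ‖v₁‖ ≤ ρ → ‖v₂‖ ≤ ρ → ‖w₁‖ ≤ ρ' → ‖w₂‖ ≤ ρ' →
      ‖f v₁ w₁ - f v₂ w₂‖ ≤ l * ‖v₁ - v₂‖ + κ * ‖w₁ - w₂‖)
    (hsmall : C * (l + κ * ∫ σ in Ioo 0 T, |ℓ σ|) ≤ 1 / 2)
    {z : ℝ → X} (hz : ContinuousOn z (Icc 0 T)) (hzρ : ∀ t ∈ Icc 0 T, ‖z t‖ ≤ ρ / 2) :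
    ∃ u : ℝ → X, (IsVolterraSolution T R ℓ f z u ∧ ∀ t ∈ Icc 0 T, ‖u t‖ ≤ ρ) ∧
      ∀ v : ℝ → X, (IsVolterraSolution T R ℓ f z v ∧ ∀ t ∈ Icc 0 T, ‖v t‖ ≤ ρ) →
        EqOn v u (Icc 0 T) := by
  set N := ∫ σ in Ioo 0 T, |ℓ σ| with hN
  have hN0 : 0 ≤ N := integral_nonneg fun _ => abs_nonneg _
  have hL : IsIntegrableKernel T (fun σ (x : X) => ℓ σ • x) fun σ => |ℓ σ| :=
    IsIntegrableKernel.smul hℓ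
  -- the nonlinearity and the fixed point map, as maps between spaces of continuous functions
  obtain ⟨G, hG⟩ : ∃ G : C(Icc 0 T, X) → C(Icc 0 T, Y), ∀ u t, G u t =
      f (u t) (∫ σ in (0 : ℝ)..t, ℓ (t - σ) • IccExtend hT.le u σ) := by
    refine ⟨fun u => ⟨_, ?_⟩, fun _ _ => rfl⟩
    exact hfc.comp (u.continuous.prodMk
      (continuousOn_iff_continuous_domRestrict.1 (hL.continuousOn_integral (continuous_IccExtend hT.le u) (norm_IccExtend_le hT.le u))))
  obtain ⟨Φ, hΦ⟩ : ∃ Φ : C(Icc 0 T, X) → C(Icc 0 T, X), ∀ u t, Φ u t =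
      z t + ∫ τ in (0 : ℝ)..t, R (t - τ) (IccExtend hT.le (G u) τ) := by
    refine ⟨fun u => ⟨_, ?_⟩, fun _ _ => rfl⟩
    exact (continuousOn_iff_continuous_domRestrict.1 hz).add
      (continuousOn_iff_continuous_domRestrict.1
        (hR.continuousOn_integral (continuous_IccExtend hT.le (G u)) (norm_IccExtend_le hT.le (G u))))
  -- solutions are the fixed points of `Φ`
  have hGeq : ∀ (u : C(Icc 0 T, X)) (v : ℝ → X), (∀ t : Icc 0 T, u t = v t) →
      ∀ t : Icc 0 T, G u t = f (v t) (∫ σ in (0 : ℝ)..t, ℓ (t - σ) • v σ) := by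
    intro u v huv t
    rw [hG, huv]
    congr 1
    refine intervalIntegral.integral_congr fun σ hσ => ?_
    rw [uIcc_of_le t.2.1] at hσ
    have hmem : σ ∈ Icc 0 T := ⟨hσ.1, hσ.2.trans t.2.2⟩
    rw [IccExtend_of_mem _ _ hmem, huv]
  have hΦeq : ∀ (u : C(Icc 0 T, X)) (v : ℝ → X), (∀ t : Icc 0 T, u t = v t) →
      ∀ t : Icc 0 T, Φ u t = z t + ∫ τ in (0 : ℝ)..t,
        R (t - τ) (f (v τ) (∫ σ in (0 : ℝ)..τ, ℓ (τ - σ) • v σ)) := by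
    intro u v huv t
    rw [hΦ]
    congr 1
    refine intervalIntegral.integral_congr fun τ hτ => ?_
    rw [uIcc_of_le t.2.1] at hτ
    have hmem : τ ∈ Icc 0 T := ⟨hτ.1, hτ.2.trans t.2.2⟩
    rw [IccExtend_of_mem _ _ hmem, hGeq u v huv]
  have hhist : ∀ u : C(Icc 0 T, X), ‖u‖ ≤ ρ → ∀ t : Icc 0 T,
      ‖∫ σ in (0 : ℝ)..t, ℓ (t - σ) • IccExtend hT.le u σ‖ ≤ ρ' := fun u hu t => by
    refine (hL.norm_integral_le hρ.le t.2 fun τ _ => (norm_IccExtend_le hT.le u τ).trans hu).trans ?_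
    simp only [abs_abs]
    linarith
  have hGlip : ∀ u₁ u₂ : C(Icc 0 T, X), ‖u₁‖ ≤ ρ → ‖u₂‖ ≤ ρ → ∀ t : Icc 0 T,
      ‖G u₁ t - G u₂ t‖ ≤ (l + κ * N) * ‖u₁ - u₂‖ := by
    intro u₁ u₂ h₁ h₂ t
    rw [hG, hG]
    refine (hf _ _ _ _ ((u₁.norm_coe_le_norm t).trans h₁) ((u₂.norm_coe_le_norm t).trans h₂)
      (hhist u₁ h₁ t) (hhist u₂ h₂ t)).trans ?_
    have e₁ : ‖u₁ t - u₂ t‖ ≤ ‖u₁ - u₂‖ := (u₁ - u₂).norm_coe_le_norm t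
    have e₂ : ‖(∫ σ in (0 : ℝ)..t, ℓ (t - σ) • IccExtend hT.le u₁ σ) -
        ∫ σ in (0 : ℝ)..t, ℓ (t - σ) • IccExtend hT.le u₂ σ‖ ≤ N * ‖u₁ - u₂‖ := by
      rw [← intervalIntegral.integral_sub (hL.intervalIntegrable (continuous_IccExtend hT.le u₁) (norm_IccExtend_le hT.le u₁) t.2)
        (hL.intervalIntegrable (continuous_IccExtend hT.le u₂) (norm_IccExtend_le hT.le u₂) t.2)]
      simp only [← smul_sub]
      have := hL.norm_integral_le (norm_nonneg (u₁ - u₂)) t.2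
        (g := fun σ => IccExtend hT.le u₁ σ - IccExtend hT.le u₂ σ)
        fun τ _ => (norm_IccExtend_le hT.le (u₁ - u₂) τ : _)
      simpa only [abs_abs] using this
    calc _ ≤ l * ‖u₁ - u₂‖ + κ * (N * ‖u₁ - u₂‖) := by gcongr
      _ = _ := by ring
  have hGzero : ∀ t, G 0 t = 0 := fun t => by
    rw [hGeq 0 0 (fun _ => rfl)]
    simp [hf0]
  have hmaps : MapsTo Φ (Metric.closedBall 0 ρ) (Metric.closedBall 0 ρ) := by
    intro u hu
    rw [mem_closedBall_zero_iff] at hu ⊢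
    rw [ContinuousMap.norm_le _ hρ.le]
    intro t
    have hb : ∀ τ, ‖IccExtend hT.le (G u) τ‖ ≤ (l + κ * N) * ρ := fun τ => by
      have := hGlip u 0 hu (by simpa using hρ.le) (projIcc 0 T hT.le τ)
      rw [hGzero, sub_zero, sub_zero] at this
      exact this.trans (by gcongr)
    have h₁ := hC t t.2 _ (continuous_IccExtend hT.le (G u)) _ hb
    have h₂ := hzρ t t.2
    rw [hΦ]
    refine (norm_add_le _ _).trans ?_
    nlinarith
  have hcontr : ∀ u₁ ∈ Metric.closedBall (0 : C(Icc 0 T, X)) ρ,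
      ∀ u₂ ∈ Metric.closedBall (0 : C(Icc 0 T, X)) ρ, dist (Φ u₁) (Φ u₂) ≤ 1 / 2 * dist u₁ u₂ := by
    intro u₁ h₁ u₂ h₂
    rw [mem_closedBall_zero_iff] at h₁ h₂
    rw [dist_eq_norm, dist_eq_norm, ContinuousMap.norm_le _ (by positivity)]
    intro t
    rw [ContinuousMap.sub_apply, hΦ, hΦ, add_sub_add_left_eq_sub,
      ← intervalIntegral.integral_sub (hR.intervalIntegrable (continuous_IccExtend hT.le _) (norm_IccExtend_le hT.le _) t.2)
        (hR.intervalIntegrable (continuous_IccExtend hT.le _) (norm_IccExtend_le hT.le _) t.2)]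
    have hsub : ∫ τ in (0 : ℝ)..t, (R (t - τ) (IccExtend hT.le (G u₁) τ) -
        R (t - τ) (IccExtend hT.le (G u₂) τ)) =
        ∫ τ in (0 : ℝ)..t, R (t - τ) (IccExtend hT.le (G u₁) τ - IccExtend hT.le (G u₂) τ) := by
      refine intervalIntegral.integral_congr_ae ?_
      have hne : ∀ᵐ τ : ℝ, τ ≠ t := by simp [ae_iff]
      filter_upwards [hne] with τ hne hτ
      rw [uIoc_of_le t.2.1] at hτ
      exact (hR.map_sub _ ⟨sub_pos.2 (lt_of_le_of_ne hτ.2 hne), by linarith [hτ.1, t.2.2]⟩ _ _).symm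
    rw [hsub]
    refine (hC t t.2 _ ((continuous_IccExtend hT.le (G u₁)).sub (continuous_IccExtend hT.le (G u₂))) ((l + κ * N) * ‖u₁ - u₂‖)
      fun τ => hGlip u₁ u₂ h₁ h₂ _).trans ?_
    rw [← mul_assoc]
    gcongr
  have hK : ContractingWith (1 / 2) (hmaps.restrict Φ _ _) := by
    refine ⟨by norm_num, LipschitzWith.of_dist_le_mul fun u₁ u₂ => ?_⟩
    exact_mod_cast hcontr u₁ u₁.2 u₂ u₂.2
  obtain ⟨u, hu, hfix, -⟩ := hK.exists_fixedPoint' Metric.isClosed_closedBall.isComplete hmaps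
    (x := 0) (by simpa using hρ.le) (edist_ne_top _ _)
  have hvu : ∀ t : Icc 0 T, u t = IccExtend hT.le u t := fun t => (IccExtend_val hT.le u t).symm
  refine ⟨IccExtend hT.le u, ⟨⟨(continuous_IccExtend hT.le u).continuousOn, fun t ht => ?_⟩, fun t ht => ?_⟩, ?_⟩
  · rw [← hΦeq u _ hvu ⟨t, ht⟩, hfix, hvu]
  · exact (norm_IccExtend_le hT.le u t).trans (mem_closedBall_zero_iff.1 hu)
  · rintro v ⟨⟨hvc, hv⟩, hvρ⟩
    let v' : C(Icc 0 T, X) := ⟨_, continuousOn_iff_continuous_domRestrict.1 hvc⟩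
    have hv' : v' ∈ Metric.closedBall (0 : C(Icc 0 T, X)) ρ := by
      rw [mem_closedBall_zero_iff, ContinuousMap.norm_le _ hρ.le]
      exact fun t => hvρ t t.2
    have hvfix : Φ v' = v' := by
      ext t
      rw [hΦeq v' v (fun _ => rfl)]
      exact (hv t t.2).symm
    have hd := hcontr v' hv' u hu
    rw [hvfix, hfix] at hd
    have heq : v' = u := dist_le_zero.1 (by linarith)
    intro t ht
    rw [IccExtend_of_mem _ _ ht, ← heq]
    rfl

end FixedPoint

/-! ### The convolution estimate -/

/-- Jensen's inequality for a weight of total mass at most one. -/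
theorem sq_integral_mul_le {w x : ℝ → ℝ} {t : ℝ} (ht : 0 ≤ t) (hw : ContinuousOn w (Icc 0 t))
    (hx : ContinuousOn x (Icc 0 t)) (hw0 : ∀ τ ∈ Icc 0 t, 0 ≤ w τ)
    (hw1 : ∫ τ in (0 : ℝ)..t, w τ ≤ 1) :
    (∫ τ in (0 : ℝ)..t, w τ * x τ) ^ 2 ≤ ∫ τ in (0 : ℝ)..t, w τ * x τ ^ 2 := by
  set c := ∫ τ in (0 : ℝ)..t, w τ * x τ with hc
  have hwi : IntervalIntegrable w volume 0 t := hw.intervalIntegrable_of_Icc ht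
  have hwx : IntervalIntegrable (fun τ => w τ * x τ) volume 0 t :=
    (hw.mul hx).intervalIntegrable_of_Icc ht
  have hwxx : IntervalIntegrable (fun τ => w τ * x τ ^ 2) volume 0 t :=
    (hw.mul (hx.pow 2)).intervalIntegrable_of_Icc ht
  have h0 : 0 ≤ ∫ τ in (0 : ℝ)..t, w τ * (x τ - c) ^ 2 :=
    intervalIntegral.integral_nonneg ht fun τ hτ => mul_nonneg (hw0 τ hτ) (sq_nonneg _)
  have hexp : ∫ τ in (0 : ℝ)..t, w τ * (x τ - c) ^ 2 =
      (∫ τ in (0 : ℝ)..t, w τ * x τ ^ 2) - 2 * c * c + c ^ 2 * ∫ τ in (0 : ℝ)..t, w τ := by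
    have hcc : 2 * c * c = ∫ τ in (0 : ℝ)..t, 2 * c * (w τ * x τ) := by
      rw [intervalIntegral.integral_const_mul]
    rw [hcc, ← intervalIntegral.integral_const_mul (c ^ 2), ← intervalIntegral.integral_sub hwxx (hwx.const_mul _),
      ← intervalIntegral.integral_add (hwxx.sub (hwx.const_mul _)) (hwi.const_mul _)]
    congr 1 with τ
    ring
  nlinarith [mul_le_mul_of_nonneg_left hw1 (sq_nonneg c)]

theorem integral_rpow_neg_comp_sub {t δ : ℝ} (hδ : δ < 1) :
    IntervalIntegrable (fun τ => (t - τ) ^ (-δ)) volume 0 t ∧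
      ∫ τ in (0 : ℝ)..t, (t - τ) ^ (-δ) = t ^ (1 - δ) * (1 - δ)⁻¹ := by
  have hi : IntervalIntegrable (fun σ : ℝ => σ ^ (-δ)) volume 0 t :=
    intervalIntegral.intervalIntegrable_rpow' (by linarith)
  refine ⟨by simpa using (hi.comp_sub_left t).symm, ?_⟩
  rw [intervalIntegral.integral_comp_sub_left (fun σ => σ ^ (-δ)) t, sub_self, sub_zero,
    integral_rpow (Or.inl (by linarith)), Real.zero_rpow (by linarith), sub_zero, div_eq_mul_inv,
    show -δ + 1 = 1 - δ by ring]

namespace DirichletEigenbasis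

variable {d : ℕ} [NeZero d] {Ω : BoundedDomain d} {E : DirichletEigenbasis Ω} {m : ℝ → ℝ}
  {μ θ : ℝ}

/-- The operators `S(t) : ℍ^{-θ} → ℍ^μ` are singular at `t = 0`, of the integrable order
`(μ + θ) / 2 < 1`. -/
theorem isIntegrableKernel_resolventNeg (hm : ConditionM m) (hμ : 0 ≤ μ) (hθ : 0 ≤ θ)
    (hμθ : μ + θ < 2) (T : ℝ) :
    IsIntegrableKernel T (E.resolventNeg m θ μ) fun t => t ^ (-((μ + θ) / 2)) where
  integrableOn := by
    rcases le_total 0 T with hT | hT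
    · rw [← intervalIntegrable_iff_integrableOn_Ioo_of_le hT]
      exact intervalIntegral.intervalIntegrable_rpow' (by linarith)
    · simp [Ioo_eq_empty_of_le hT]
  norm_le t ht F := norm_resolventNeg_le hm hμ hθ hμθ.le ht.1 F
  map_sub t ht F F' := resolventNeg_sub hm hμ hθ hμθ.le ht.1 F F'
  measurable g hg := by
    have hcont : ContinuousOn (fun t => E.resolventNeg m θ μ t (g t)) (Ioi 0) := by
      intro t₀ ht₀
      have hpos : (0 : ℝ) < t₀ := ht₀
      rw [ContinuousWithinAt, tendsto_iff_norm_sub_tendsto_zero]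
      have h₁ : Tendsto (fun t => t ^ (-((μ + θ) / 2)) * ‖g t - g t₀‖ +
          ‖E.resolventNeg m θ μ t (g t₀) - E.resolventNeg m θ μ t₀ (g t₀)‖) (𝓝[Ioi 0] t₀)
          (𝓝 (t₀ ^ (-((μ + θ) / 2)) * ‖g t₀ - g t₀‖ +
            ‖E.resolventNeg m θ μ t₀ (g t₀) - E.resolventNeg m θ μ t₀ (g t₀)‖)) := by
        refine Tendsto.add (Tendsto.mul ?_ ?_) ?_
        · exact (Real.continuousAt_rpow_const _ _ (Or.inl hpos.ne')).continuousWithinAt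
        · exact ((hg.sub continuous_const).norm.continuousAt).continuousWithinAt
        · exact ((continuousOn_resolventNeg hm hμ hθ hμθ.le (g t₀) t₀ ht₀).sub_const _).norm
      rw [sub_self, sub_self, norm_zero, norm_zero, mul_zero, add_zero] at h₁
      refine squeeze_zero' (Eventually.of_forall fun _ => norm_nonneg _) ?_ h₁
      filter_upwards [self_mem_nhdsWithin] with t ht
      have := norm_resolventNeg_le (E := E) hm hμ hθ hμθ.le ht (g t - g t₀)
      rw [resolventNeg_sub hm hμ hθ hμθ.le ht] at this
      exact (norm_sub_le_norm_sub_add_norm_sub _ _ _).trans (by gcongr)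
    exact (hcont.mono Ioo_subset_Ioi_self).aestronglyMeasurable measurableSet_Ioo

/-- The convolution estimate with the sharp power of `t`. In the `n`-th coordinate, Jensen's
inequality for the weight `λₙ ω(t - τ, λₙ)`, whose mass is at most one, leaves the factor
`λₙ^δ ω(t - τ, λₙ) ≤ (t - τ)^{-δ}`, which does not depend on `n`. -/
theorem norm_integral_resolventNeg_le (hm : ConditionM m) (hμ : 0 ≤ μ) (hθ : 0 ≤ θ) {δ : ℝ}
    (hδ₀ : 0 ≤ δ) (hδ₁ : δ < 1) (hμθ : μ + θ = 1 + δ) {t : ℝ} (ht : 0 ≤ t)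
    {g : ℝ → E.HNeg θ} (hg : Continuous g) {M : ℝ} (hM : ∀ τ, ‖g τ‖ ≤ M) :
    ‖∫ τ in (0 : ℝ)..t, E.resolventNeg m θ μ (t - τ) (g τ)‖ ≤
      Real.sqrt (t ^ (1 - δ) * (1 - δ)⁻¹) * M := by
  have hM0 : 0 ≤ M := (norm_nonneg _).trans (hM 0)
  have := H.completeSpace (E := E) hμ
  have hint := (isIntegrableKernel_resolventNeg (E := E) hm hμ hθ (by linarith) t).intervalIntegrable
    hg hM ⟨ht, le_rfl⟩
  obtain ⟨hpi, hpow⟩ := integral_rpow_neg_comp_sub (t := t) hδ₁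
  set V := ∫ τ in (0 : ℝ)..t, E.resolventNeg m θ μ (t - τ) (g τ) with hV
  have hne : ∀ᵐ τ : ℝ, τ ≠ t := by simp [ae_iff]
  let b : ℕ → ℝ → ℝ := fun n τ => E.lam n ^ (-(θ / 2)) * g τ (E.eigen θ n)
  let w : ℕ → ℝ → ℝ := fun n τ => E.lam n * relaxation m (t - τ) (E.lam n)
  let x : ℕ → ℝ → ℝ := fun n τ => E.lam n ^ ((δ - 1) / 2) * b n τ
  have hbc : ∀ n, Continuous (b n) := fun n =>
    continuous_const.mul (hg.clm_apply continuous_const)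
  have hxc : ∀ n, Continuous (x n) := fun n => continuous_const.mul (hbc n)
  have hwc : ∀ n, ContinuousOn (w n) (Icc 0 t) := fun n =>
    continuousOn_const.mul ((hm.relaxation_continuousOn (E.lam_pos n)).comp (by fun_prop)
      fun τ hτ => sub_nonneg.2 hτ.2)
  have hw0 : ∀ n, ∀ τ ∈ Icc 0 t, 0 ≤ w n τ := fun n τ hτ =>
    mul_nonneg (E.lam_pos n).le (hm.relaxation_nonneg (E.lam_pos n) (sub_nonneg.2 hτ.2))
  have hw1 : ∀ n, ∫ τ in (0 : ℝ)..t, w n τ ≤ 1 := fun n => by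
    have e := intervalIntegral.integral_comp_sub_left (a := 0) (b := t)
      (fun σ => relaxation m σ (E.lam n)) t
    simp only [sub_self, sub_zero] at e
    rw [intervalIntegral.integral_const_mul, e]
    exact hm.mul_integral_relaxation_le_one (E.lam_pos n) ht
  have hcoord : ∀ n, H.toSeq E μ V n = ∫ τ in (0 : ℝ)..t, w n τ * x n τ := fun n => by
    rw [← H.coord_apply, hV, ← ContinuousLinearMap.intervalIntegral_comp_comm _ hint]
    refine intervalIntegral.integral_congr_ae ?_
    filter_upwards [hne] with τ hne hτ
    rw [uIoc_of_le ht] at hτ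
    rw [H.coord_apply, toSeq_resolventNeg hm hμ hθ (by linarith)
      (sub_pos.2 (lt_of_le_of_ne hτ.2 hne)), hμθ]
    simp only [w, x, b]
    rw [show (1 + δ) / 2 = 1 + (δ - 1) / 2 by ring, Real.rpow_add (E.lam_pos n), Real.rpow_one]
    ring
  have hwx : ∀ n τ, w n τ * x n τ ^ 2 =
      E.lam n ^ δ * relaxation m (t - τ) (E.lam n) * b n τ ^ 2 := fun n τ => by
    simp only [w, x]
    rw [mul_pow, ← Real.rpow_natCast (E.lam n ^ ((δ - 1) / 2)) 2, ← Real.rpow_mul (E.lam_pos n).le,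
      show δ = 1 + (δ - 1) / 2 * (2 : ℕ) by push_cast; ring, Real.rpow_add (E.lam_pos n),
      Real.rpow_one]
    push_cast
    ring_nf
  have hwxi : ∀ n, IntervalIntegrable (fun τ => w n τ * x n τ ^ 2) volume 0 t := fun n =>
    ((hwc n).mul ((hxc n).continuousOn.pow 2)).intervalIntegrable_of_Icc ht
  have hsum : ‖V‖ ^ 2 ≤ t ^ (1 - δ) * (1 - δ)⁻¹ * M ^ 2 := by
    rw [H.norm_sq_eq_tsum_toSeq]
    refine (H.summable_toSeq_sq V).tsum_le_of_sum_le fun s => ?_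
    calc ∑ n ∈ s, H.toSeq E μ V n ^ 2
        ≤ ∑ n ∈ s, ∫ τ in (0 : ℝ)..t, w n τ * x n τ ^ 2 := by
          refine Finset.sum_le_sum fun n _ => ?_
          rw [hcoord]
          exact sq_integral_mul_le ht (hwc n) (hxc n).continuousOn (hw0 n) (hw1 n)
      _ = ∫ τ in (0 : ℝ)..t, ∑ n ∈ s, w n τ * x n τ ^ 2 :=
          (intervalIntegral.integral_finsetSum fun n _ => hwxi n).symm
      _ ≤ ∫ τ in (0 : ℝ)..t, (t - τ) ^ (-δ) * M ^ 2 := by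
          refine intervalIntegral.integral_mono_ae_restrict ht
            (by simpa only [Finset.sum_fn] using IntervalIntegrable.sum s fun n _ => hwxi n) (hpi.mul_const _) ?_
          rw [EventuallyLE, ae_restrict_iff' measurableSet_Icc]
          filter_upwards [hne] with τ hne hτ
          have hpos : 0 < t - τ := sub_pos.2 (lt_of_le_of_ne hτ.2 hne)
          calc ∑ n ∈ s, w n τ * x n τ ^ 2 ≤ ∑ n ∈ s, (t - τ) ^ (-δ) * b n τ ^ 2 := by
                refine Finset.sum_le_sum fun n _ => ?_
                rw [hwx]
                exact mul_le_mul_of_nonneg_right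
                  (hm.rpow_mul_relaxation_le (E.lam_pos n) hpos hδ₀ hδ₁.le) (sq_nonneg _)
            _ = (t - τ) ^ (-δ) * ∑ n ∈ s, b n τ ^ 2 := (Finset.mul_sum ..).symm
            _ ≤ (t - τ) ^ (-δ) * M ^ 2 := by
                refine mul_le_mul_of_nonneg_left ?_ (Real.rpow_nonneg hpos.le _)
                calc ∑ n ∈ s, b n τ ^ 2 ≤ ‖g τ‖ ^ 2 := by
                      rw [HNeg.norm_sq hθ]
                      exact (HNeg.summable_sq hθ (g τ)).sum_le_tsum s fun _ _ => sq_nonneg _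
                  _ ≤ M ^ 2 := pow_le_pow_left₀ (norm_nonneg _) (hM τ) 2
      _ = _ := by rw [intervalIntegral.integral_mul_const, hpow]
  have hC0 : 0 ≤ t ^ (1 - δ) * (1 - δ)⁻¹ :=
    mul_nonneg (Real.rpow_nonneg ht _) (inv_nonneg.2 (by linarith))
  refine le_of_sq_le_sq ?_ (by positivity)
  rwa [mul_pow, Real.sq_sqrt hC0]

/-- Local Lipschitz continuity makes the nonlinearity jointly continuous. -/
theorem ConditionF.continuous {f : E.H μ → E.H μ → E.HNeg θ} {L K : ℝ → ℝ}
    (hf : ConditionF E μ θ f L K) : Continuous fun p : E.H μ × E.H μ => f p.1 p.2 := by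
  rw [continuous_iff_continuousAt]
  rintro ⟨v, w⟩
  rw [ContinuousAt, tendsto_iff_norm_sub_tendsto_zero]
  have hlim : Tendsto (fun p : E.H μ × E.H μ => L (‖v‖ + 1) * ‖p.1 - v‖ + K (‖w‖ + 1) * ‖p.2 - w‖)
      (𝓝 (v, w)) (𝓝 (L (‖v‖ + 1) * ‖v - v‖ + K (‖w‖ + 1) * ‖w - w‖)) :=
    Continuous.tendsto (by fun_prop) (v, w)
  simp only [sub_self, norm_zero, mul_zero, add_zero] at hlim
  refine squeeze_zero' (Eventually.of_forall fun _ => norm_nonneg _) ?_ hlim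
  have h₁ : ∀ᶠ p : E.H μ × E.H μ in 𝓝 (v, w), ‖p.1‖ < ‖v‖ + 1 :=
    (continuous_fst.norm.tendsto (v, w)).eventually_lt_const (by simp)
  have h₂ : ∀ᶠ p : E.H μ × E.H μ in 𝓝 (v, w), ‖p.2‖ < ‖w‖ + 1 :=
    (continuous_snd.norm.tendsto (v, w)).eventually_lt_const (by simp)
  filter_upwards [h₁, h₂] with p hp₁ hp₂
  exact hf.lipschitz _ _ (by positivity) (by positivity) _ _ _ _ hp₁.le (by linarith) hp₂.le
    (by linarith)

end DirichletEigenbasis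

/-! ### Small data -/

/-- Near zero the Lipschitz constants are close enough to their upper limits to keep a strict
inequality between continuous functions of those limits. -/
theorem exists_radius_of_limsup {L K : ℝ → ℝ} {Lstar Kstar : ℝ}
    (hL : limsup (fun ρ => (L ρ : EReal)) (𝓝[>] 0) = (Lstar : EReal))
    (hK : limsup (fun ρ => (K ρ : EReal)) (𝓝[>] 0) = (Kstar : EReal))
    {c N : ℝ} (hsmall : c * (Lstar ^ 2 + Kstar ^ 2 * N ^ 2) < 1) :
    ∃ l k r : ℝ, 0 < r ∧ c * (l ^ 2 + k ^ 2 * N ^ 2) < 1 ∧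
      ∀ ρ ∈ Ioc 0 r, L ρ ≤ l ∧ K ρ ≤ k := by
  have hlim : Tendsto (fun ε : ℝ => c * ((Lstar + ε) ^ 2 + (Kstar + ε) ^ 2 * N ^ 2)) (𝓝[>] 0)
      (𝓝 (c * ((Lstar + 0) ^ 2 + (Kstar + 0) ^ 2 * N ^ 2))) :=
    tendsto_nhdsWithin_of_tendsto_nhds (Continuous.tendsto (by fun_prop) 0)
  simp only [add_zero] at hlim
  obtain ⟨ε, hε, hε0⟩ := ((hlim.eventually_lt_const hsmall).and self_mem_nhdsWithin).exists
  have hLe : ∀ᶠ ρ in 𝓝[>] 0, (L ρ : EReal) < ((Lstar + ε : ℝ) : EReal) :=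
    eventually_lt_of_limsup_lt (by rw [hL]; exact_mod_cast (by linarith))
  have hKe : ∀ᶠ ρ in 𝓝[>] 0, (K ρ : EReal) < ((Kstar + ε : ℝ) : EReal) :=
    eventually_lt_of_limsup_lt (by rw [hK]; exact_mod_cast (by linarith))
  obtain ⟨r, hr, hsub⟩ := mem_nhdsGT_iff_exists_Ioc_subset.1 (hLe.and hKe)
  refine ⟨Lstar + ε, Kstar + ε, r, hr, hε, fun ρ hρ => ?_⟩
  obtain ⟨h₁, h₂⟩ := hsub hρ
  exact ⟨(EReal.coe_lt_coe_iff.1 h₁).le, (EReal.coe_lt_coe_iff.1 h₂).le⟩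

theorem theorem3p1 {d : ℕ} [NeZero d] (Ω : BoundedDomain d) (E : DirichletEigenbasis Ω)
    (m : ℝ → ℝ) (hm : ConditionM m)
    (T : ℝ) (hT : 0 < T)
    (ℓ : ℝ → ℝ) (hℓ : IntegrableOn ℓ (Ioo 0 T))
    (μ θ δ : ℝ) (hδ₀ : 0 < δ) (hδ₁ : δ < 1) (hθ : θ = 1 + δ - μ)
    (f : E.H μ → E.H μ → E.HNeg θ) (L K : ℝ → ℝ)
    (hf : DirichletEigenbasis.ConditionF E μ θ f L K)
    (Lstar Kstar : ℝ)
    (hL : limsup (fun ρ => (L ρ : EReal)) (𝓝[>] 0) = (Lstar : EReal))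
    (hK : limsup (fun ρ => (K ρ : EReal)) (𝓝[>] 0) = (Kstar : EReal))
    (hsmall : 8 * T ^ (1 - δ) * (1 - δ)⁻¹ *
      (Lstar ^ 2 + Kstar ^ 2 * (∫ t in Ioo 0 T, |ℓ t|) ^ 2) < 1) :
    ∃ ρstar : ℝ, 0 < ρstar ∧
      ∀ ξ : E.H μ, ‖ξ‖ ≤ ρstar / 2 →
        ∃ u : ℝ → E.H μ,
          (E.IsMildSolution m ℓ T μ θ f ξ u ∧ ∀ t ∈ Icc 0 T, ‖u t‖ ≤ ρstar) ∧
          ∀ v : ℝ → E.H μ,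
            (E.IsMildSolution m ℓ T μ θ f ξ v ∧ ∀ t ∈ Icc 0 T, ‖v t‖ ≤ ρstar) →
              EqOn v u (Icc 0 T) := by
  have hμ := hf.mu_pos.le
  have hθ0 := hf.theta_pos.le
  have hμθ : μ + θ = 1 + δ := by rw [hθ]; ring
  have := DirichletEigenbasis.H.completeSpace (E := E) hμ
  obtain ⟨l, k, r, hr, hlk, hLK⟩ := exists_radius_of_limsup hL hK hsmall
  set N := ∫ t in Ioo 0 T, |ℓ t| with hN
  have hN0 : 0 ≤ N := integral_nonneg fun _ => abs_nonneg _
  set A := T ^ (1 - δ) * (1 - δ)⁻¹ with hA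
  have hA0 : 0 ≤ A := mul_nonneg (Real.rpow_nonneg hT.le _) (inv_nonneg.2 (by linarith))
  -- the history of a function bounded by `ρ` is bounded by `ρ * N ≤ r`
  set ρ := r / (N + 1) with hρ
  have hρ0 : 0 < ρ := by positivity
  have hρN : ρ * (N + 1) = r := div_mul_cancel₀ _ (by positivity)
  have hρr : ρ ≤ r := by nlinarith
  have hLρ := hf.L_nonneg ρ hρ0
  have hKr := hf.K_nonneg r hr
  have hLl := (hLK ρ ⟨hρ0, hρr⟩).1
  have hKk := (hLK r ⟨hr, le_rfl⟩).2
  have hcontr : Real.sqrt A * (L ρ + K r * N) ≤ 1 / 2 := by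
    refine le_of_sq_le_sq ?_ (by norm_num)
    rw [mul_pow, Real.sq_sqrt hA0]
    have h₁ : (L ρ + K r * N) ^ 2 ≤ 2 * (l ^ 2 + k ^ 2 * N ^ 2) := by
      have e₁ : L ρ ^ 2 ≤ l ^ 2 := pow_le_pow_left₀ hLρ hLl 2
      have e₂ : K r ^ 2 * N ^ 2 ≤ k ^ 2 * N ^ 2 :=
        mul_le_mul_of_nonneg_right (pow_le_pow_left₀ hKr hKk 2) (sq_nonneg _)
      nlinarith [sq_nonneg (L ρ - K r * N)]
    have h₂ := mul_le_mul_of_nonneg_left h₁ hA0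
    rw [mul_assoc 8, ← hA] at hlk
    linarith
  refine ⟨ρ, hρ0, fun ξ hξ => ?_⟩
  exact exists_unique_volterraSolution hT
    (DirichletEigenbasis.isIntegrableKernel_resolventNeg hm hμ hθ0 (by linarith) T) hℓ
    (C := Real.sqrt A)
    (fun t ht g hg M hM =>
      (DirichletEigenbasis.norm_integral_resolventNeg_le hm hμ hθ0 hδ₀.le hδ₁ hμθ ht.1 hg hM).trans
        (mul_le_mul_of_nonneg_right (Real.sqrt_le_sqrt (mul_le_mul_of_nonneg_right
          (Real.rpow_le_rpow ht.1 ht.2 (by linarith)) (inv_nonneg.2 (by linarith))))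
          ((norm_nonneg _).trans (hM 0))))
    hf.continuous hf.map_zero hρ0 hLρ hKr (ρ' := r) (by nlinarith)
    (hf.lipschitz ρ r hρ0 hr) hcontr
    ((DirichletEigenbasis.continuousOn_resolvent hm hμ ξ).mono Icc_subset_Ici_self)
    (fun t ht => (DirichletEigenbasis.norm_resolvent_le hm hμ ht.1 ξ).trans hξ)
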